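/- Let $L,T,\alpha,K>0$, $\Omega=(0,L]\times(0,T]$, $\bar\Omega=[0,L]\times[0,T]$, and let $a\in C^3(\bar\Omega)$ (independent of $\varepsilon$) satisfy $a\ge\alpha>0$ on $\bar\Omega$ and $a_t(0,0)=0$. Then there is a constant $C>0$, depending only on $L,T,\alpha,K,a$, such that the following holds for every $\varepsilon\in(0,1]$ and every $f\in C^2([0,L])$ (which may depend on $\varepsilon$) with $$|f^{(i)}(x)|\le K\,x^{2-i}\varepsilon^{i-3}e^{-x/\varepsilon},\qquad 0\le x\le L,\quad i=0,1,2 .$$ Let $w\in C^0(\bar\Omega)\cap C^1(\Omega)$ be the solution of $$w_t+a\,w_x=f(x)\ \text{ in }\Omega,\qquad w(0,t)=0,\ 0\le t\le T,\qquad a(x,0)\,w_x(x,0)=f(x),\ 0\le x\le L .$$ Let $N\ge2$ be even and $M\ge1$. Put $\sigma=\min\{L/2,\ \varepsilon\ln N\}$, and let $0=x_0<x_1<\dots<x_N=L$ be the Shishkin mesh that divides each of $[0,\sigma]$ and $[\sigma,L]$ into $N/2$ intervals of equal length; let $t_j=jT/M$, $0\le j\le M$. Let $W$ be the mesh function with $$\frac{W(x_i,t_j)-W(x_i,t_{j-1})}{t_j-t_{j-1}}+a(x_i,t_j)\frac{W(x_i,t_j)-W(x_{i-1},t_j)}{x_i-x_{i-1}}=f(x_i),\qquad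 1\le i\le N,\ 1\le j\le M,$$ $$W(0,t_j)=0,\ 0\le j\le M,\qquad a(x_i,0)\frac{W(x_i,0)-W(x_{i-1},0)}{x_i-x_{i-1}}=f(x_i),\ 1\le i\le N,$$ and let $\bar W$ be its piecewise bilinear interpolant on $\bar\Omega$. Then $$\sup_{(x,t)\in\bar\Omega}|\bar W(x,t)-w(x,t)|\le C N^{-1}(\ln N)^2+C M^{-1}.$$ -/

import Mathlib

namespace Transport

open Set

/-- The closed space-time rectangle `[0, L] × [0, T]`. -/
def closedDomain (L T : ℝ) : Set (ℝ × ℝ) := Icc 0 L ×ˢ Icc 0 T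

/-- The domain `(0, L] × (0, T]` on which the transport equation is posed. -/
def domain (L T : ℝ) : Set (ℝ × ℝ) := Ioc 0 L ×ˢ Ioc 0 T

/-- The partial derivative in `x` on `[0, L]` (one-sided at the end points). -/
noncomputable def partialX (L : ℝ) (u : ℝ → ℝ → ℝ) (x t : ℝ) : ℝ :=
  derivWithin (fun y => u y t) (Icc 0 L) x

/-- The partial derivative in `t` on `[0, T]` (one-sided at the end points). -/
noncomputable def partialT (T : ℝ) (u : ℝ → ℝ → ℝ) (x t : ℝ) : ℝ :=
  derivWithin (fun s => u x s) (Icc 0 T) t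

/-- Admissible velocity: `a ∈ C³([0, L] × [0, T])`, `a ≥ α`, and `a_t(0, 0) = 0`. -/
structure IsVelocity (L T α : ℝ) (a : ℝ → ℝ → ℝ) : Prop where
  smooth : ContDiffOn ℝ 3 (fun p : ℝ × ℝ => a p.1 p.2) (closedDomain L T)
  lower_bound : ∀ x ∈ Icc 0 L, ∀ t ∈ Icc 0 T, α ≤ a x t
  deriv_corner : partialT T a 0 0 = 0

/-- Admissible forcing term: `f ∈ C²([0, L])` with a layer at the inflow `x = 0`,
`|f⁽ⁱ⁾(x)| ≤ K x²⁻ⁱ εⁱ⁻³ exp (-x / ε)` for `i = 0, 1, 2`. -/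
structure IsLayerForcing (L K ε : ℝ) (f : ℝ → ℝ) : Prop where
  smooth : ContDiffOn ℝ 2 f (Icc 0 L)
  bound : ∀ i : ℕ, i ≤ 2 → ∀ x ∈ Icc 0 L,
    |iteratedDerivWithin i f (Icc 0 L) x| ≤
      K * (x ^ (2 - i) / ε ^ (3 - i)) * Real.exp (-x / ε)

/-- `w` is a classical solution, in `C⁰([0, L] × [0, T]) ∩ C¹((0, L] × (0, T])`, of
`w_t + a w_x = f` with `w(0, t) = 0` and with the initial data determined by
`a(x, 0) w_x(x, 0) = f(x)` and `w(0, 0) = 0`. -/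
structure IsLayerSolution (L T : ℝ) (a : ℝ → ℝ → ℝ) (f : ℝ → ℝ) (w : ℝ → ℝ → ℝ) : Prop where
  cont : ContinuousOn (fun p : ℝ × ℝ => w p.1 p.2) (closedDomain L T)
  smooth : ContDiffOn ℝ 1 (fun p : ℝ × ℝ => w p.1 p.2) (domain L T)
  pde : ∀ x ∈ Ioc 0 L, ∀ t ∈ Ioc 0 T, partialT T w x t + a x t * partialX L w x t = f x
  inflow : ∀ t ∈ Icc 0 T, w 0 t = 0
  initial_differentiable : DifferentiableOn ℝ (fun x => w x 0) (Icc 0 L)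
  initial : ∀ x ∈ Icc 0 L, a x 0 * partialX L w x 0 = f x

/-- The transition point `σ = min (L / 2, ε ln N)`. -/
noncomputable def transitionPoint (L ε : ℝ) (N : ℕ) : ℝ := min (L / 2) (ε * Real.log N)

/-- The nodes `x_0, …, x_N` (for even `N`) of the Shishkin mesh: `[0, σ]` and `[σ, L]` are each
divided into `N / 2` intervals of equal length. -/
noncomputable def shishkinNode (L ε : ℝ) (N i : ℕ) : ℝ :=
  if i ≤ N / 2 then (i : ℝ) * (2 * transitionPoint L ε N / N)
  else transitionPoint L ε N
    + ((i : ℝ) - (N : ℝ) / 2) * (2 * (L - transitionPoint L ε N) / N)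

/-- The nodes `t_j = j T / M` of the uniform mesh in time. -/
noncomputable def uniformNode (T : ℝ) (M j : ℕ) : ℝ := (j : ℝ) * (T / M)

/-- The backward difference quotient of `Y` at the `i`-th node of the mesh `z` (for `i ≥ 1`). -/
noncomputable def backwardDiff (z Y : ℕ → ℝ) (i : ℕ) : ℝ :=
  (Y i - Y (i - 1)) / (z i - z (i - 1))

/-- `W i j`, for `i ≤ N` and `j ≤ M`, is the solution of the upwind scheme on the mesh with nodes
`(x i, t j)`. -/
structure IsUpwindSolution (a : ℝ → ℝ → ℝ) (f : ℝ → ℝ) (N M : ℕ) (x t : ℕ → ℝ)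
    (W : ℕ → ℕ → ℝ) : Prop where
  scheme : ∀ i ∈ Finset.Icc 1 N, ∀ j ∈ Finset.Icc 1 M,
    backwardDiff t (fun l => W i l) j + a (x i) (t j) * backwardDiff x (fun l => W l j) i = f (x i)
  inflow : ∀ j ≤ M, W 0 j = 0
  initial : ∀ i ∈ Finset.Icc 1 N, a (x i) 0 * backwardDiff x (fun l => W l 0) i = f (x i)

open Classical in
/-- The standard hat function centred at the `i`-th node of the mesh `z 0 < z 1 < ⋯ < z n`;
for `i = 0` and `i = n` only one half of the hat is present. -/
noncomputable def hat (n : ℕ) (z : ℕ → ℝ) (i : ℕ) (y : ℝ) : ℝ :=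
  if 1 ≤ i ∧ y ∈ Icc (z (i - 1)) (z i) then (y - z (i - 1)) / (z i - z (i - 1))
  else if i < n ∧ y ∈ Icc (z i) (z (i + 1)) then (z (i + 1) - y) / (z (i + 1) - z i)
  else 0

/-- The piecewise bilinear interpolant of the mesh function `W`. -/
noncomputable def interpolant (N M : ℕ) (x t : ℕ → ℝ) (W : ℕ → ℕ → ℝ) (y s : ℝ) : ℝ :=
  ∑ i ∈ Finset.range (N + 1), ∑ j ∈ Finset.range (M + 1), W i j * hat N x i y * hat M t j s

end Transport

/-!
The argument reverses the usual roles of the two solutions: regularity is established for the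
discrete solution `W`, and stability is used for the continuous problem. Thus nothing has to be
known about derivatives of `w` beyond the equation itself, and the interpolation error need not be
treated separately.

*Regularity of `W`.* With `b = 1 / a`, the scheme reads `b D_t W + D_x W = b f`. It also holds on
the initial level when `D_t W` is set to `0` there, which is what the discrete initial condition
says. Differencing once and twice in time gives schemes of the same kind for `P = D_t W` and for
`D_t P`, with sources bounded by multiples of `|f|` and of lower-order terms. The bound
`|f| ≤ 8 K μ`, with `μ = layerWeight ε`, shows that `f` is bounded in `L¹` uniformly in `ε`, and
`1 + μ` has the bounded primitive `layerPrimitive ε`, which does not depend on time and is a barrier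
function; so `discrete_stability` bounds `P` and `D_t P`. The initial value of `D_t P` is bounded
because `a_t(0, 0) = 0` makes its source `O((x + k) |f|)` with time step `k`, and `x |f|` is bounded
(`IsUpwindSolution.abs_timeDiff_one_le`). The scheme then yields `|D_x W|, |D_x P| ≤ C (1 + μ)`
(`IsUpwindSolution.exists_abs_spaceDiff_le`).

*Residual.* On each cell the bilinear interpolant satisfies the transport equation up to
`C (h + k) (1 + μ)`, where `h` is the mesh width in space
(`IsUpwindSolution.abs_residual_le`). The oscillation of `f` on a cell is of this form because
`|f'| ≤ 2 K μ`. The Shishkin mesh enters through its mesh width `h ≤ 2 L / N`.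

*Comparison.* At a maximum of a function on the rectangle, away from the inflow boundary and from
the initial line, the left derivatives in `x` and in `t` are nonnegative. Left derivatives of the
interpolant are those of its bilinear pieces, so a multiple of `layerPrimitive ε` dominates the
error in both directions (`nonpos_of_transport_neg_on_cells`, `error_le_barrier`).
-/

namespace Transport

open Set

/-! ### Quantitative bounds on the velocity -/

/-- The consequences of `IsVelocity` that enter the error analysis: bounds on `a` and on time
differences, of first and second order, of its reciprocal `1 / a`. -/
structure VelocityBounds (L T α A Λ : ℝ) (a : ℝ → ℝ → ℝ) : Prop where
  lower : ∀ x ∈ Icc 0 L, ∀ t ∈ Icc 0 T, α ≤ a x t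
  upper : ∀ x ∈ Icc 0 L, ∀ t ∈ Icc 0 T, a x t ≤ A
  lipschitz : ∀ x ∈ Icc 0 L, ∀ t ∈ Icc 0 T, ∀ y ∈ Icc 0 L, ∀ s ∈ Icc 0 T,
    |a x t - a y s| ≤ Λ * (|x - y| + |t - s|)
  inv_lipschitz : ∀ x ∈ Icc 0 L, ∀ t ∈ Icc 0 T, ∀ s ∈ Icc 0 T,
    |(a x t)⁻¹ - (a x s)⁻¹| ≤ Λ * |t - s|
  inv_second_diff : ∀ x ∈ Icc 0 L, ∀ s k : ℝ, 0 ≤ s → 0 ≤ k → s + 2 * k ≤ T →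
    |((a x (s + 2 * k))⁻¹ - (a x (s + k))⁻¹) - ((a x (s + k))⁻¹ - (a x s)⁻¹)| ≤ Λ * k ^ 2
  inv_corner : ∀ x ∈ Icc 0 L, ∀ t ∈ Icc 0 T,
    |(a x t)⁻¹ - (a x 0)⁻¹| ≤ Λ * (x + t) * t

theorem uniqueDiffOn_closedDomain {L T : ℝ} (hL : 0 < L) (hT : 0 < T) :
    UniqueDiffOn ℝ (closedDomain L T) :=
  (uniqueDiffOn_Icc hL).prod (uniqueDiffOn_Icc hT)

theorem isCompact_closedDomain (L T : ℝ) : IsCompact (closedDomain L T) :=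
  isCompact_Icc.prod isCompact_Icc

theorem convex_closedDomain (L T : ℝ) : Convex ℝ (closedDomain L T) :=
  (convex_Icc 0 L).prod (convex_Icc 0 T)

theorem exists_lipschitz_const {L T : ℝ} (hL : 0 < L) (hT : 0 < T) {g : ℝ × ℝ → ℝ}
    (hg : ContDiffOn ℝ 1 g (closedDomain L T)) :
    ∃ Λ : ℝ, 0 ≤ Λ ∧ ∀ p ∈ closedDomain L T, ∀ q ∈ closedDomain L T,
      |g p - g q| ≤ Λ * (|p.1 - q.1| + |p.2 - q.2|) := by
  obtain ⟨Λ, hΛ⟩ := (isCompact_closedDomain L T).exists_bound_of_continuousOn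
    (hg.continuousOn_fderivWithin (uniqueDiffOn_closedDomain hL hT) le_rfl)
  refine ⟨max Λ 0, le_max_right _ _, fun p hp q hq => ?_⟩
  have h := (convex_closedDomain L T).norm_image_sub_le_of_norm_fderivWithin_le
    (hg.differentiableOn one_ne_zero) (fun x hx => (hΛ x hx).trans (le_max_left Λ 0)) hq hp
  rw [Real.norm_eq_abs] at h
  refine h.trans (mul_le_mul_of_nonneg_left ?_ (le_max_right _ _))
  rw [Prod.norm_def]
  exact max_le (le_add_of_nonneg_right (abs_nonneg _)) (le_add_of_nonneg_left (abs_nonneg _))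

/-- The time derivative of a `C²` function on the closed rectangle is Lipschitz. -/
theorem exists_partialT_lipschitz {L T : ℝ} (hL : 0 < L) (hT : 0 < T) {b : ℝ → ℝ → ℝ}
    (hb : ContDiffOn ℝ 2 (fun p : ℝ × ℝ => b p.1 p.2) (closedDomain L T)) :
    ∃ (Λ : ℝ) (b' : ℝ → ℝ → ℝ), 0 ≤ Λ ∧
      (∀ x ∈ Icc 0 L, ∀ t ∈ Icc 0 T, HasDerivWithinAt (fun s => b x s) (b' x t) (Icc 0 T) t) ∧
      ∀ x ∈ Icc 0 L, ∀ t ∈ Icc 0 T, ∀ y ∈ Icc 0 L, ∀ s ∈ Icc 0 T,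
        |b' x t - b' y s| ≤ Λ * (|x - y| + |t - s|) := by
  have hd : ContDiffOn ℝ 1
      (fderivWithin ℝ (fun p : ℝ × ℝ => b p.1 p.2) (closedDomain L T)) (closedDomain L T) :=
    hb.fderivWithin (uniqueDiffOn_closedDomain hL hT) (by norm_num)
  obtain ⟨Λ, h0, hΛ⟩ := exists_lipschitz_const hL hT
    (hd.clm_apply (contDiffOn_const (c := ((0 : ℝ), (1 : ℝ)))))
  refine ⟨Λ, fun x t => fderivWithin ℝ (fun p : ℝ × ℝ => b p.1 p.2) (closedDomain L T) (x, t)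
    (0, 1), h0, fun x hx t ht => ?_, fun x hx t ht y hy s hs => hΛ (x, t) ⟨hx, ht⟩ (y, s) ⟨hy, hs⟩⟩
  have h1 := (hb.differentiableOn two_ne_zero (x, t) ⟨hx, ht⟩).hasFDerivWithinAt
  have h2 : HasDerivWithinAt (fun s : ℝ => (x, s)) ((0 : ℝ), (1 : ℝ)) (Icc 0 T) t :=
    (hasDerivWithinAt_const t (Icc 0 T) x).prodMk (hasDerivWithinAt_id t (Icc 0 T))
  exact h1.comp_hasDerivWithinAt t h2 (fun s hs => ⟨hx, hs⟩)

theorem IsVelocity.exists_bounds {L T α : ℝ} (hL : 0 < L) (hT : 0 < T) (hα : 0 < α)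
    {a : ℝ → ℝ → ℝ} (ha : IsVelocity L T α a) :
    ∃ A Λ : ℝ, 0 < A ∧ 0 < Λ ∧ VelocityBounds L T α A Λ a := by
  have hpos : ∀ p ∈ closedDomain L T, 0 < a p.1 p.2 :=
    fun p hp => hα.trans_le (ha.lower_bound p.1 hp.1 p.2 hp.2)
  have hb : ContDiffOn ℝ 2 (fun p : ℝ × ℝ => (a p.1 p.2)⁻¹) (closedDomain L T) :=
    (ha.smooth.of_le (by norm_num)).inv fun p hp => (hpos p hp).ne'
  obtain ⟨A, hA⟩ := (isCompact_closedDomain L T).exists_bound_of_continuousOn ha.smooth.continuousOn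
  obtain ⟨Λ₁, h₁, hΛ₁⟩ := exists_lipschitz_const hL hT (ha.smooth.of_le (by norm_num))
  obtain ⟨Λ₂, h₂, hΛ₂⟩ := exists_lipschitz_const hL hT (hb.of_le (by norm_num))
  obtain ⟨Λ₃, b', h₃, hb', hΛ₃⟩ := exists_partialT_lipschitz hL hT (b := fun x t => (a x t)⁻¹) hb
  have h0L : (0 : ℝ) ∈ Icc 0 L := ⟨le_rfl, hL.le⟩
  have h0T : (0 : ℝ) ∈ Icc 0 T := ⟨le_rfl, hT.le⟩
  -- `(1 / a)_t` vanishes at the corner, since `a_t` does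
  have hcorner : b' 0 0 = 0 := by
    obtain ⟨Λ, a', -, ha', -⟩ := exists_partialT_lipschitz hL hT (ha.smooth.of_le (by norm_num))
    have hu := uniqueDiffOn_Icc hT 0 h0T
    have e1 : a' 0 0 = 0 := by
      rw [← (ha' 0 h0L 0 h0T).derivWithin hu]
      exact ha.deriv_corner
    have e2 := (ha' 0 h0L 0 h0T).fun_inv (hpos (0, 0) ⟨h0L, h0T⟩).ne'
    rw [e1, neg_zero, zero_div] at e2
    exact hu.eq_deriv _ (hb' 0 h0L 0 h0T) e2
  have hle : ∀ {u v : ℝ}, u ≤ Λ₁ + Λ₂ + Λ₃ + 1 → 0 ≤ v → u * v ≤ (Λ₁ + Λ₂ + Λ₃ + 1) * v :=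
    fun h hv => mul_le_mul_of_nonneg_right h hv
  refine ⟨|A| + 1, Λ₁ + Λ₂ + Λ₃ + 1, by positivity, by positivity, ha.lower_bound,
    ?_, ?_, ?_, ?_, ?_⟩
  · intro x hx t ht
    have := hA (x, t) ⟨hx, ht⟩
    rw [Real.norm_eq_abs] at this
    linarith [le_abs_self (a x t), le_abs_self A]
  · intro x hx t ht y hy s hs
    exact (hΛ₁ (x, t) ⟨hx, ht⟩ (y, s) ⟨hy, hs⟩).trans (hle (by linarith) (by positivity))
  · intro x hx t ht s hs
    have := hΛ₂ (x, t) ⟨hx, ht⟩ (x, s) ⟨hx, hs⟩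
    simp only [sub_self, abs_zero, zero_add] at this
    exact this.trans (hle (by linarith) (by positivity))
  · intro x hx s k hs hk hsk
    have hd : ∀ r ∈ Icc s (s + k), HasDerivWithinAt
        (fun r => (a x (r + k))⁻¹ - (a x r)⁻¹) (b' x (r + k) - b' x r) (Icc s (s + k)) r := by
      intro r hr
      have hr1 : r ∈ Icc 0 T := ⟨by linarith [hr.1], by linarith [hr.2]⟩
      have hr2 : r + k ∈ Icc 0 T := ⟨by linarith [hr.1], by linarith [hr.2]⟩
      refine HasDerivWithinAt.fun_sub ?_ ((hb' x hx r hr1).mono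
        fun y hy => ⟨by linarith [hy.1], by linarith [hy.2]⟩)
      have h1 : HasDerivWithinAt (fun y => y + k) 1 (Icc s (s + k)) r :=
        (hasDerivWithinAt_id r (Icc s (s + k))).add_const k
      have := HasDerivWithinAt.scomp (h := fun y => y + k) r (hb' x hx (r + k) hr2) h1
        (fun y hy => (⟨by linarith [hy.1], by linarith [hy.2]⟩ : y + k ∈ Icc 0 T))
      simpa [Function.comp_def] using this
    have h := (convex_Icc s (s + k)).norm_image_sub_le_of_norm_hasDerivWithin_le (C := Λ₃ * k) hd
      (fun r hr => by
        have := hΛ₃ x hx (r + k) ⟨by linarith [hr.1], by linarith [hr.2]⟩ x hx r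
          ⟨by linarith [hr.1], by linarith [hr.2]⟩
        simpa [abs_of_nonneg hk] using this)
      (⟨le_rfl, by linarith⟩ : s ∈ Icc s (s + k)) (⟨by linarith, le_rfl⟩ : s + k ∈ Icc s (s + k))
    have e : s + k + k = s + 2 * k := by ring
    simp only [Real.norm_eq_abs, e, add_sub_cancel_left, abs_of_nonneg hk] at h
    refine h.trans ?_
    rw [mul_assoc, ← sq]
    exact hle (by linarith) (by positivity)
  · intro x hx t ht
    have h := (convex_Icc 0 t).norm_image_sub_le_of_norm_hasDerivWithin_le
      (f := fun s => (a x s)⁻¹) (f' := fun s => b' x s) (C := Λ₃ * (x + t))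
      (fun r hr => (hb' x hx r ⟨hr.1, hr.2.trans ht.2⟩).mono
        fun y hy => ⟨hy.1, hy.2.trans ht.2⟩)
      (fun r hr => by
        have := hΛ₃ x hx r ⟨hr.1, hr.2.trans ht.2⟩ 0 h0L 0 h0T
        rw [hcorner, sub_zero, sub_zero, sub_zero, abs_of_nonneg hx.1, abs_of_nonneg hr.1] at this
        exact this.trans (mul_le_mul_of_nonneg_left (by linarith [hr.2]) h₃))
      (⟨le_rfl, ht.1⟩ : (0 : ℝ) ∈ Icc 0 t) (⟨ht.1, le_rfl⟩ : t ∈ Icc 0 t)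
    simp only [Real.norm_eq_abs, sub_zero, abs_of_nonneg ht.1] at h
    refine h.trans ?_
    rw [mul_assoc, mul_assoc]
    exact hle (by linarith) (mul_nonneg (by linarith [hx.1, ht.1]) ht.1)

/-! ### The layer function and the forcing term -/

/-- The layer function `ε⁻¹ exp (-x / (2 ε))`, which majorizes the forcing term. -/
noncomputable def layerWeight (ε x : ℝ) : ℝ := ε⁻¹ * Real.exp (-x / (2 * ε))

/-- The primitive of `1 + layerWeight ε` that vanishes at `0`; it serves as a barrier function, in
the discrete and in the continuous setting. -/
noncomputable def layerPrimitive (ε x : ℝ) : ℝ := x + 2 * (1 - Real.exp (-x / (2 * ε)))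

theorem layerWeight_nonneg {ε : ℝ} (hε : 0 < ε) (x : ℝ) : 0 ≤ layerWeight ε x := by
  unfold layerWeight; positivity

theorem layerWeight_anti {ε x y : ℝ} (hε : 0 < ε) (h : x ≤ y) :
    layerWeight ε y ≤ layerWeight ε x := by
  unfold layerWeight
  gcongr

theorem layerPrimitive_zero (ε : ℝ) : layerPrimitive ε 0 = 0 := by simp [layerPrimitive]

theorem layerPrimitive_nonneg {ε x : ℝ} (hε : 0 < ε) (hx : 0 ≤ x) : 0 ≤ layerPrimitive ε x := by
  have : Real.exp (-x / (2 * ε)) ≤ 1 :=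
    Real.exp_le_one_iff.2 (div_nonpos_of_nonpos_of_nonneg (by linarith) (by linarith))
  unfold layerPrimitive
  linarith

theorem layerPrimitive_le (ε x : ℝ) : layerPrimitive ε x ≤ x + 2 := by
  have := Real.exp_pos (-x / (2 * ε))
  unfold layerPrimitive
  linarith

theorem hasDerivAt_layerPrimitive {ε : ℝ} (hε : 0 < ε) (x : ℝ) :
    HasDerivAt (layerPrimitive ε) (1 + layerWeight ε x) x := by
  have h : HasDerivAt (fun y : ℝ => Real.exp (-y / (2 * ε)))
      (Real.exp (-x / (2 * ε)) * (-1 / (2 * ε))) x :=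
    ((hasDerivAt_id x).neg.div_const (2 * ε)).exp
  have h' := (hasDerivAt_id x).add ((h.const_sub 1).const_mul 2)
  refine h'.congr_deriv ?_
  unfold layerWeight
  field_simp

/-- The concave function `layerPrimitive` grows on `[x, y]` at least as fast as its derivative at
the right end point prescribes. -/
theorem layerPrimitive_sub {ε x y : ℝ} (hε : 0 < ε) :
    (y - x) * (1 + layerWeight ε y) ≤ layerPrimitive ε y - layerPrimitive ε x := by
  have h1 : Real.exp (-x / (2 * ε)) = Real.exp (-y / (2 * ε)) * Real.exp ((y - x) / (2 * ε)) := by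
    rw [← Real.exp_add]; congr 1; ring
  have h2 := mul_le_mul_of_nonneg_left (Real.add_one_le_exp ((y - x) / (2 * ε)))
    (Real.exp_pos (-y / (2 * ε))).le
  have h3 : (y - x) * layerWeight ε y
      = 2 * (Real.exp (-y / (2 * ε)) * ((y - x) / (2 * ε))) := by
    unfold layerWeight; field_simp
  rw [mul_add, mul_one, h3]
  unfold layerPrimitive
  rw [h1]
  linarith

theorem sq_mul_exp_neg_le {z : ℝ} (hz : 0 ≤ z) :
    z ^ 2 * Real.exp (-z) ≤ 8 * Real.exp (-(z / 2)) := by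
  have h := Real.pow_div_factorial_le_exp (z / 2) (by linarith) 2
  have e : Real.exp (-(z / 2)) = Real.exp (-z) * Real.exp (z / 2) := by
    rw [← Real.exp_add]; congr 1; ring
  rw [e]
  have := mul_le_mul_of_nonneg_left h (Real.exp_pos (-z)).le
  norm_num [Nat.factorial] at this
  linarith

theorem cube_mul_exp_neg_le {z : ℝ} (hz : 0 ≤ z) : z ^ 3 * Real.exp (-z) ≤ 6 := by
  have h := Real.pow_div_factorial_le_exp z hz 3
  have := mul_le_mul_of_nonneg_left h (Real.exp_pos (-z)).le
  rw [← Real.exp_add] at this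
  norm_num [Nat.factorial] at this
  linarith

theorem mul_exp_neg_le {z : ℝ} : z * Real.exp (-z) ≤ 2 * Real.exp (-(z / 2)) := by
  have h := Real.add_one_le_exp (z / 2)
  have e : Real.exp (-(z / 2)) = Real.exp (-z) * Real.exp (z / 2) := by
    rw [← Real.exp_add]; congr 1; ring
  rw [e]
  nlinarith [mul_le_mul_of_nonneg_left h (Real.exp_pos (-z)).le, Real.exp_pos (-z)]

namespace IsLayerForcing

variable {L K ε : ℝ} {f : ℝ → ℝ}

theorem abs_le_aux (hf : IsLayerForcing L K ε f) {x : ℝ} (hx : x ∈ Icc 0 L) :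
    |f x| ≤ K * ε⁻¹ * ((x / ε) ^ 2 * Real.exp (-(x / ε))) := by
  have h := hf.bound 0 (by norm_num) x hx
  rw [iteratedDerivWithin_zero] at h
  refine h.trans (le_of_eq ?_)
  rw [neg_div]
  ring

theorem const_nonneg (hf : IsLayerForcing L K ε f) (hL : 0 < L) (hε : 0 < ε) : 0 ≤ K := by
  have h := (abs_nonneg _).trans (hf.abs_le_aux (⟨hL.le, le_rfl⟩ : L ∈ Icc 0 L))
  rw [mul_assoc] at h
  exact nonneg_of_mul_nonneg_left h (by positivity)

theorem abs_le (hf : IsLayerForcing L K ε f) (hL : 0 < L) (hε : 0 < ε) {x : ℝ}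
    (hx : x ∈ Icc 0 L) : |f x| ≤ 8 * K * layerWeight ε x := by
  have hK := hf.const_nonneg hL hε
  have hz : 0 ≤ x / ε := div_nonneg hx.1 hε.le
  refine (hf.abs_le_aux hx).trans ((mul_le_mul_of_nonneg_left (sq_mul_exp_neg_le hz)
    (by positivity)).trans (le_of_eq ?_))
  have : -(x / ε / 2) = -x / (2 * ε) := by field_simp
  rw [this, layerWeight]
  ring

theorem mul_abs_le (hf : IsLayerForcing L K ε f) (hL : 0 < L) (hε : 0 < ε) {x : ℝ}
    (hx : x ∈ Icc 0 L) : x * |f x| ≤ 6 * K := by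
  have hK := hf.const_nonneg hL hε
  have hz : 0 ≤ x / ε := div_nonneg hx.1 hε.le
  calc x * |f x| ≤ x * (K * ε⁻¹ * ((x / ε) ^ 2 * Real.exp (-(x / ε)))) :=
        mul_le_mul_of_nonneg_left (hf.abs_le_aux hx) hx.1
    _ = K * ((x / ε) ^ 3 * Real.exp (-(x / ε))) := by ring
    _ ≤ K * 6 := mul_le_mul_of_nonneg_left (cube_mul_exp_neg_le hz) hK
    _ = 6 * K := by ring

theorem abs_sub_le (hf : IsLayerForcing L K ε f) (hL : 0 < L) (hε : 0 < ε) {x y : ℝ}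
    (hx : 0 ≤ x) (hxy : x ≤ y) (hy : y ≤ L) :
    |f y - f x| ≤ 2 * K * layerWeight ε x * (y - x) := by
  have hK := hf.const_nonneg hL hε
  have hsub : Icc x y ⊆ Icc 0 L := Icc_subset_Icc hx hy
  have hd : ∀ z ∈ Icc x y, HasDerivWithinAt f (derivWithin f (Icc 0 L) z) (Icc x y) z :=
    fun z hz => ((hf.smooth.differentiableOn two_ne_zero) z (hsub hz)).hasDerivWithinAt.mono hsub
  have h := (convex_Icc x y).norm_image_sub_le_of_norm_hasDerivWithin_le
    (C := 2 * K * layerWeight ε x) hd (fun z hz => by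
      have h1 := hf.bound 1 (by norm_num) z (hsub hz)
      rw [iteratedDerivWithin_one] at h1
      refine h1.trans ?_
      calc K * (z ^ (2 - 1) / ε ^ (3 - 1)) * Real.exp (-z / ε)
          = K * ε⁻¹ * (z / ε * Real.exp (-(z / ε))) := by
            rw [neg_div]; norm_num; field_simp
        _ ≤ K * ε⁻¹ * (2 * Real.exp (-(z / ε / 2))) :=
            mul_le_mul_of_nonneg_left mul_exp_neg_le (by positivity)
        _ = 2 * K * layerWeight ε z := by
            have : -(z / ε / 2) = -z / (2 * ε) := by field_simp
            rw [this, layerWeight]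
            ring
        _ ≤ 2 * K * layerWeight ε x :=
            mul_le_mul_of_nonneg_left (layerWeight_anti hε hz.1) (by positivity))
    (⟨le_rfl, hxy⟩ : x ∈ Icc x y) (⟨hxy, le_rfl⟩ : y ∈ Icc x y)
  simpa [Real.norm_eq_abs, abs_of_nonneg (sub_nonneg.2 hxy)] using h

end IsLayerForcing

/-! ### Stability of the upwind scheme -/

/-- One implicit step of a scheme with positive weights `p` and `q`. -/
theorem abs_implicit_step {p q y u v r : ℝ} (hp : 0 ≤ p) (hq : 0 ≤ q)
    (h : |p * (y - u) + q * (y - v)| ≤ r) : (p + q) * |y| ≤ p * |u| + q * |v| + r := by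
  calc (p + q) * |y| = |p * u + q * v + (p * (y - u) + q * (y - v))| := by
        rw [← abs_of_nonneg (add_nonneg hp hq), ← abs_mul]; congr 1; ring
    _ ≤ |p * u| + |q * v| + |p * (y - u) + q * (y - v)| :=
        (abs_add_le _ _).trans (add_le_add_left (abs_add_le _ _) _)
    _ ≤ p * |u| + q * |v| + r := by
        rw [abs_mul, abs_mul, abs_of_nonneg hp, abs_of_nonneg hq]; linarith

/-- Discrete comparison principle. The mesh function `G`, whose difference quotient majorizes the
source, does not depend on time; the zero-order term costs an exponential factor. -/
theorem discrete_stability {N M : ℕ} {x G : ℕ → ℝ} {β Y : ℕ → ℕ → ℝ} {k c β₀ : ℝ}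
    (hk : 0 < k) (hc : 0 ≤ c) (hβ₀ : 0 < β₀) (hx : ∀ i < N, x i < x (i + 1))
    (hβ : ∀ i < N, ∀ j < M, β₀ ≤ β (i + 1) (j + 1)) (hG : ∀ i < N, G i ≤ G (i + 1))
    (h0 : ∀ i ≤ N, |Y i 0| ≤ G i) (hin : ∀ j ≤ M, |Y 0 j| ≤ G 0)
    (h : ∀ i < N, ∀ j < M,
      |β (i + 1) (j + 1) * ((Y (i + 1) (j + 1) - Y (i + 1) j) / k)
          + (Y (i + 1) (j + 1) - Y i (j + 1)) / (x (i + 1) - x i)|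
        ≤ c * |Y (i + 1) j| + (G (i + 1) - G i) / (x (i + 1) - x i)) :
    ∀ j ≤ M, ∀ i ≤ N, |Y i j| ≤ G i * (1 + c * k / β₀) ^ j := by
  intro j
  induction j with
  | zero => intro _ i hi; simpa using h0 i hi
  | succ j ihj =>
    intro hj i
    have hρ : 1 ≤ 1 + c * k / β₀ := le_add_of_nonneg_right (by positivity)
    have hρj : 1 ≤ (1 + c * k / β₀) ^ (j + 1) := one_le_pow₀ hρ
    induction i with
    | zero =>
      intro _
      exact (hin _ hj).trans
        (le_mul_of_one_le_right ((abs_nonneg _).trans (hin 0 (Nat.zero_le _))) hρj)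
    | succ i ihi =>
      intro hi
      have hh : 0 < x (i + 1) - x i := sub_pos.2 (hx i hi)
      have hb := hβ i hi j hj
      set p := β (i + 1) (j + 1) / k with hp
      set q := (x (i + 1) - x i)⁻¹ with hq
      have hp0 : 0 < p := div_pos (hβ₀.trans_le hb) hk
      have hq0 : 0 < q := inv_pos.2 hh
      have hu := ihj (by omega) (i + 1) hi
      have hv := ihi (by omega)
      have hs := h i hi j hj
      have e : β (i + 1) (j + 1) * ((Y (i + 1) (j + 1) - Y (i + 1) j) / k)
          + (Y (i + 1) (j + 1) - Y i (j + 1)) / (x (i + 1) - x i)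
          = p * (Y (i + 1) (j + 1) - Y (i + 1) j) + q * (Y (i + 1) (j + 1) - Y i (j + 1)) := by
        rw [hp, hq]; ring
      rw [e] at hs
      have hstep := abs_implicit_step hp0.le hq0.le hs
      have hGi : 0 ≤ G (i + 1) := (abs_nonneg _).trans (h0 (i + 1) hi)
      have hE : 0 ≤ (1 + c * k / β₀) ^ j := by positivity
      have hpk : c ≤ p * (c * k / β₀) := by
        have : p * (c * k / β₀) = c * (β (i + 1) (j + 1) / β₀) := by rw [hp]; field_simp
        rw [this]
        exact le_mul_of_one_le_right hc ((one_le_div hβ₀).2 hb)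
      rw [div_eq_mul_inv, ← hq] at hstep
      have k1 := mul_le_mul_of_nonneg_left hu (add_nonneg hp0.le hc)
      have k2 := mul_le_mul_of_nonneg_left hv hq0.le
      have k3 := mul_le_mul_of_nonneg_right hpk (mul_nonneg hGi hE)
      have k4 : 0 ≤ (G (i + 1) - G i) * q * ((1 + c * k / β₀) ^ (j + 1) - 1) :=
        mul_nonneg (mul_nonneg (sub_nonneg.2 (hG i hi)) hq0.le) (sub_nonneg.2 hρj)
      refine le_of_mul_le_mul_left ?_ (add_pos hp0 hq0)
      rw [pow_succ] at *
      linarith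

/-! ### Differences of the discrete solution -/

/-- `x 0 < x 1 < ⋯ < x N` is a mesh on `[0, L]`. -/
structure IsMesh (L : ℝ) (N : ℕ) (x : ℕ → ℝ) : Prop where
  zero : x 0 = 0
  lt : ∀ i < N, x i < x (i + 1)
  last : x N = L

theorem IsMesh.mono {L : ℝ} {N : ℕ} {x : ℕ → ℝ} (hx : IsMesh L N x) {i j : ℕ} (hij : i ≤ j)
    (hj : j ≤ N) : x i ≤ x j := by
  induction j, hij using Nat.le_induction with
  | base => exact le_rfl
  | succ j _ ih => exact (ih (by omega)).trans (hx.lt j hj).le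

theorem IsMesh.mem {L : ℝ} {N : ℕ} {x : ℕ → ℝ} (hx : IsMesh L N x) {i : ℕ} (hi : i ≤ N) :
    x i ∈ Icc 0 L :=
  ⟨hx.zero ▸ hx.mono (Nat.zero_le i) hi, hx.last ▸ hx.mono hi le_rfl⟩

theorem isMesh_uniformNode {T : ℝ} (hT : 0 < T) {M : ℕ} (hM : 1 ≤ M) :
    IsMesh T M (uniformNode T M) := by
  have hM' : (0 : ℝ) < M := by exact_mod_cast hM
  refine ⟨by simp [uniformNode], fun i _ => ?_, ?_⟩
  · unfold uniformNode
    have : 0 < T / M := by positivity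
    push_cast
    linarith
  · unfold uniformNode
    field_simp

theorem uniformNode_succ (T : ℝ) (M j : ℕ) :
    uniformNode T M (j + 1) = uniformNode T M j + T / M := by
  unfold uniformNode
  push_cast
  ring

/-- The backward time difference quotient of a mesh function with time step `k`. The value at the
initial time level is set to `0`: this is the value for which the upwind scheme extends to the
initial level, in view of the discretization of the initial condition. -/
noncomputable def timeDiff (k : ℝ) (W : ℕ → ℕ → ℝ) (i : ℕ) : ℕ → ℝ
  | 0 => 0
  | j + 1 => (W i (j + 1) - W i j) / k

theorem one_add_pow_le_exp {c k β T : ℝ} {j : ℕ} (hc : 0 ≤ c) (hk : 0 ≤ k) (hβ : 0 < β)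
    (hj : j * k ≤ T) : (1 + c * k / β) ^ j ≤ Real.exp (c * T / β) := by
  calc (1 + c * k / β) ^ j ≤ Real.exp (c * k / β) ^ j := by
        gcongr
        linarith [Real.add_one_le_exp (c * k / β)]
    _ = Real.exp (c * (j * k) / β) := by rw [← Real.exp_nat_mul]; congr 1; ring
    _ ≤ Real.exp (c * T / β) := by gcongr

section DiscreteBounds

variable {L T α A Λ K ε : ℝ} {a : ℝ → ℝ → ℝ} {f : ℝ → ℝ} {N M : ℕ} {x : ℕ → ℝ}
  {W : ℕ → ℕ → ℝ}

/-- The upwind scheme on all time levels, solved for the difference quotient in space. -/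
theorem IsUpwindSolution.spaceDiff_eq (hα : 0 < α) (hv : VelocityBounds L T α A Λ a)
    (hx : IsMesh L N x) (ht : IsMesh T M (uniformNode T M))
    (hW : IsUpwindSolution a f N M x (uniformNode T M) W) {i j : ℕ} (hi : i < N) (hj : j ≤ M) :
    (W (i + 1) j - W i j) / (x (i + 1) - x i)
      = (a (x (i + 1)) (uniformNode T M j))⁻¹ * (f (x (i + 1)) - timeDiff (T / M) W (i + 1) j) := by
  have ha := (hα.trans_le (hv.lower _ (hx.mem hi) _ (ht.mem hj))).ne'
  have hi' : i + 1 ∈ Finset.Icc 1 N := Finset.mem_Icc.2 ⟨by omega, hi⟩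
  rw [eq_inv_mul_iff_mul_eq₀ ha]
  cases j with
  | zero =>
    have h := hW.initial (i + 1) hi'
    simp only [backwardDiff, Nat.add_sub_cancel] at h
    rw [timeDiff, sub_zero, ← h, ht.zero]
  | succ j =>
    have h := hW.scheme (i + 1) hi' (j + 1) (Finset.mem_Icc.2 ⟨by omega, hj⟩)
    simp only [backwardDiff, Nat.add_sub_cancel] at h
    rw [uniformNode_succ, add_sub_cancel_left, ← uniformNode_succ] at h
    rw [timeDiff, ← h]
    ring

/-- The difference of the scheme on two successive time levels. -/
theorem IsUpwindSolution.spaceDiff_timeDiff_eq (hα : 0 < α) (hT : 0 < T)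
    (hv : VelocityBounds L T α A Λ a)
    (hx : IsMesh L N x) (ht : IsMesh T M (uniformNode T M))
    (hW : IsUpwindSolution a f N M x (uniformNode T M) W) {i j : ℕ} (hi : i < N) (hj : j < M)
    {b : ℕ → ℝ} (hb : ∀ j, b j = (a (x (i + 1)) (uniformNode T M j))⁻¹) {P : ℕ → ℕ → ℝ}
    (hP : P = timeDiff (T / M) W) :
    (P (i + 1) (j + 1) - P i (j + 1)) / (x (i + 1) - x i)
      = (f (x (i + 1)) - P (i + 1) j) * ((b (j + 1) - b j) / (T / M))
        - b (j + 1) * ((P (i + 1) (j + 1) - P (i + 1) j) / (T / M)) := by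
  have h1 := hW.spaceDiff_eq hα hv hx ht hi hj
  have h0 := hW.spaceDiff_eq hα hv hx ht hi hj.le
  rw [← hb, ← hP] at h1 h0
  have hM : (0 : ℝ) < M := by exact_mod_cast (Nat.zero_le j).trans_lt hj
  have hh : x (i + 1) - x i ≠ 0 := (sub_pos.2 (hx.lt i hi)).ne'
  have hk : T / M ≠ 0 := by positivity
  generalize T / (M : ℝ) = k at *
  have e : (P (i + 1) (j + 1) - P i (j + 1)) / (x (i + 1) - x i)
      = ((W (i + 1) (j + 1) - W i (j + 1)) / (x (i + 1) - x i)
          - (W (i + 1) j - W i j) / (x (i + 1) - x i)) / k := by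
    simp only [hP, timeDiff]
    field_simp
    ring
  rw [e, h1, h0]
  field_simp
  ring

theorem IsUpwindSolution.timeDiff_inflow (hW : IsUpwindSolution a f N M x (uniformNode T M) W)
    {j : ℕ} (hj : j ≤ M) : timeDiff (T / M) W 0 j = 0 := by
  cases j with
  | zero => rfl
  | succ j => rw [timeDiff, hW.inflow _ hj, hW.inflow _ (by omega), sub_zero, zero_div]

theorem VelocityBounds.inv_bounds (hα : 0 < α) (hv : VelocityBounds L T α A Λ a) {y s : ℝ}
    (hy : y ∈ Icc 0 L) (hs : s ∈ Icc 0 T) : A⁻¹ ≤ (a y s)⁻¹ ∧ (a y s)⁻¹ ≤ α⁻¹ :=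
  have h := hα.trans_le (hv.lower y hy s hs)
  ⟨inv_anti₀ h (hv.upper y hy s hs), inv_anti₀ hα (hv.lower y hy s hs)⟩

theorem VelocityBounds.abs_timeDiff_inv_le (hT : 0 < T)
    (hv : VelocityBounds L T α A Λ a) (ht : IsMesh T M (uniformNode T M)) {y : ℝ}
    (hy : y ∈ Icc 0 L) {j : ℕ} (hj : j < M) :
    |((a y (uniformNode T M (j + 1)))⁻¹ - (a y (uniformNode T M j))⁻¹) / (T / M)| ≤ Λ := by
  have hM : (0 : ℝ) < M := by exact_mod_cast (Nat.zero_le j).trans_lt hj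
  have hk : 0 < T / M := by positivity
  have h := hv.inv_lipschitz y hy _ (ht.mem (Nat.succ_le_of_lt hj)) _ (ht.mem hj.le)
  rw [Nat.succ_eq_add_one, uniformNode_succ, add_sub_cancel_left, abs_of_pos hk] at h
  rw [abs_div, abs_of_pos hk, div_le_iff₀ hk, uniformNode_succ]
  exact h

theorem VelocityBounds.abs_timeDiff_timeDiff_inv_le (hT : 0 < T)
    (hv : VelocityBounds L T α A Λ a) (ht : IsMesh T M (uniformNode T M)) {y : ℝ}
    (hy : y ∈ Icc 0 L) {j : ℕ} (hj : j + 1 < M) :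
    |(((a y (uniformNode T M (j + 2)))⁻¹ - (a y (uniformNode T M (j + 1)))⁻¹) / (T / M)
      - ((a y (uniformNode T M (j + 1)))⁻¹ - (a y (uniformNode T M j))⁻¹) / (T / M)) / (T / M)|
      ≤ Λ := by
  have hM : (0 : ℝ) < M := by exact_mod_cast (Nat.zero_le _).trans_lt hj
  have hk : 0 < T / M := by positivity
  have e1 := uniformNode_succ T M j
  have e2 : uniformNode T M (j + 2) = uniformNode T M j + 2 * (T / M) := by
    rw [uniformNode_succ, e1]; ring
  have h := hv.inv_second_diff y hy (uniformNode T M j) (T / M) (ht.mem (by omega)).1 hk.le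
    (e2 ▸ (ht.mem (Nat.succ_le_of_lt hj)).2)
  rw [← e1, ← e2] at h
  rw [← sub_div, div_div, abs_div, abs_of_pos (mul_pos hk hk), div_le_iff₀ (mul_pos hk hk), ← sq]
  exact h

/-- The discrete time derivative is bounded, uniformly in `ε` and in the mesh: its source is
bounded in `L¹`. -/
theorem IsUpwindSolution.abs_timeDiff_le (hL : 0 < L) (hT : 0 < T) (hα : 0 < α) (hA : 0 < A)
    (hΛ : 0 < Λ) (hε : 0 < ε) (hv : VelocityBounds L T α A Λ a) (hf : IsLayerForcing L K ε f)
    (hx : IsMesh L N x) (ht : IsMesh T M (uniformNode T M))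
    (hW : IsUpwindSolution a f N M x (uniformNode T M) W) {i j : ℕ} (hi : i ≤ N) (hj : j ≤ M) :
    |timeDiff (T / M) W i j| ≤ 8 * K * Λ * (L + 2) * Real.exp (Λ * T / A⁻¹) := by
  have hK := hf.const_nonneg hL hε
  obtain rfl | hM0 := Nat.eq_zero_or_pos M
  · obtain rfl : j = 0 := by omega
    simp only [timeDiff, abs_zero]
    positivity
  have hM : (0 : ℝ) < M := by exact_mod_cast hM0
  have hk : 0 < T / M := by positivity
  have hmem : ∀ {i}, i ≤ N → 0 ≤ layerPrimitive ε (x i) :=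
    fun h => layerPrimitive_nonneg hε (hx.mem h).1
  have key := discrete_stability (N := N) (M := M) (x := x)
    (G := fun i => 8 * K * Λ * layerPrimitive ε (x i))
    (β := fun i j => (a (x i) (uniformNode T M j))⁻¹) (Y := timeDiff (T / M) W) (k := T / M)
    (c := Λ) (β₀ := A⁻¹) hk hΛ.le (inv_pos.2 hA) hx.lt
    (fun i hi j hj => (hv.inv_bounds hα (hx.mem hi) (ht.mem hj)).1)
    (fun i hi => by
      have h1 := layerPrimitive_sub (x := x i) (y := x (i + 1)) hε
      have h2 := sub_pos.2 (hx.lt i hi)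
      have h3 := layerWeight_nonneg hε (x (i + 1))
      exact mul_le_mul_of_nonneg_left (by nlinarith) (by positivity))
    (fun i hi => by
      simp only [timeDiff, abs_zero]
      exact mul_nonneg (by positivity) (hmem hi))
    (fun j hj => by
      rw [hW.timeDiff_inflow hj, abs_zero]
      exact mul_nonneg (by positivity) (hmem (Nat.zero_le _)))
    (fun i hi j hj => by
      rw [hW.spaceDiff_timeDiff_eq hα hT hv hx ht hi hj (fun _ => rfl) rfl, add_sub_cancel]
      have hb := hv.abs_timeDiff_inv_le hT ht (hx.mem hi) hj
      have hd := sub_pos.2 (hx.lt i hi)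
      have hF := hf.abs_le hL hε (hx.mem hi)
      have hm : layerWeight ε (x (i + 1))
          ≤ (layerPrimitive ε (x (i + 1)) - layerPrimitive ε (x i)) / (x (i + 1) - x i) := by
        rw [le_div_iff₀ hd]
        have := layerPrimitive_sub (x := x i) (y := x (i + 1)) hε
        nlinarith
      rw [← mul_sub, mul_div_assoc, abs_mul]
      calc _ ≤ (|f (x (i + 1))| + |timeDiff (T / M) W (i + 1) j|) * Λ :=
            mul_le_mul (abs_sub _ _) hb (abs_nonneg _) (by positivity)
        _ ≤ _ := by
            have := mul_le_mul_of_nonneg_left hm (by positivity : 0 ≤ 8 * K * Λ)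
            have := mul_le_mul_of_nonneg_right hF hΛ.le
            linarith) j hj i hi
  refine key.trans (mul_le_mul (mul_le_mul_of_nonneg_left ?_ (by positivity))
    (one_add_pow_le_exp hΛ.le hk.le (inv_pos.2 hA) (ht.mem hj).2) (by positivity)
    (mul_nonneg (by positivity) (by linarith)))
  exact (layerPrimitive_le ε _).trans (by linarith [(hx.mem hi).2])

/-- The first discrete second time derivative is bounded. This is where the corner condition
`a_t(0, 0) = 0` enters: the source is at most `(x + k) |f|`, and `x |f|` is bounded. -/
theorem IsUpwindSolution.abs_timeDiff_one_le (hL : 0 < L) (hT : 0 < T) (hα : 0 < α) (hA : 0 < A)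
    (hΛ : 0 < Λ) (hε : 0 < ε) (hv : VelocityBounds L T α A Λ a) (hf : IsLayerForcing L K ε f)
    (hx : IsMesh L N x) (ht : IsMesh T M (uniformNode T M))
    (hW : IsUpwindSolution a f N M x (uniformNode T M) W) (hM : 1 ≤ M) {i : ℕ} (hi : i ≤ N) :
    |timeDiff (T / M) W i 1| / (T / M)
      ≤ 6 * K * Λ * A + 8 * K * Λ * layerPrimitive ε (x i) := by
  have hK := hf.const_nonneg hL hε
  have hM' : (0 : ℝ) < M := by exact_mod_cast hM
  have hk : 0 < T / M := by positivity
  induction i with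
  | zero =>
    rw [hW.timeDiff_inflow hM, abs_zero, zero_div, hx.zero, layerPrimitive_zero]
    positivity
  | succ i ih =>
    have hmem := hx.mem hi
    have hd := sub_pos.2 (hx.lt i hi)
    have ih := ih (by omega)
    have e := hW.spaceDiff_timeDiff_eq hα hT hv hx ht hi hM (fun _ => rfl) rfl
    have e0 : timeDiff (T / M) W (i + 1) 0 = 0 := rfl
    have ht1 : uniformNode T M 1 = T / M := by simp [uniformNode]
    rw [zero_add, e0, sub_zero, sub_zero, ht.zero, ht1] at e
    have hkT : T / M ∈ Icc 0 T := ht1 ▸ ht.mem hM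
    have hb := (hv.inv_bounds hα hmem hkT).1
    have hc := hv.inv_corner _ hmem _ hkT
    have hF := hf.abs_le hL hε hmem
    have hxF := hf.mul_abs_le hL hε hmem
    have hm := layerPrimitive_sub (x := x i) (y := x (i + 1)) hε
    set P := timeDiff (T / M) W
    set m := layerPrimitive ε
    set b := (a (x (i + 1)) (T / M))⁻¹
    set b0 := (a (x (i + 1)) 0)⁻¹
    set F := f (x (i + 1))
    set k := T / (M : ℝ)
    set h := x (i + 1) - x i
    have hb0 : 0 < b := (inv_pos.2 hA).trans_le hb
    have hstep : (b / k + h⁻¹) * |P (i + 1) 1|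
        ≤ b / k * |(0 : ℝ)| + h⁻¹ * |P i 1| + |F| * (Λ * (x (i + 1) + k)) := by
      refine abs_implicit_step (by positivity) (by positivity) ?_
      have e2 : b / k * (P (i + 1) 1 - 0) + h⁻¹ * (P (i + 1) 1 - P i 1) = F * ((b - b0) / k) := by
        rw [inv_mul_eq_div, e]; ring
      rw [e2, abs_mul, abs_div, abs_of_pos hk]
      exact mul_le_mul_of_nonneg_left ((div_le_iff₀ hk).2 hc) (abs_nonneg _)
    rw [abs_zero, mul_zero, zero_add] at hstep
    rw [div_le_iff₀ hk] at ih ⊢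
    have hh : 0 < h⁻¹ := inv_pos.2 hd
    refine le_of_mul_le_mul_left (hstep.trans ?_) (by positivity : 0 < b / k + h⁻¹)
    have k1 := mul_le_mul_of_nonneg_left ih hh.le
    have k2 := mul_le_mul_of_nonneg_left hxF hΛ.le
    have k3 := mul_le_mul_of_nonneg_left hF (by positivity : 0 ≤ Λ * k)
    have k4 : layerWeight ε (x (i + 1)) ≤ h⁻¹ * (m (x (i + 1)) - m (x i)) := by
      rw [inv_mul_eq_div, le_div_iff₀ hd]
      linarith
    have k5 := mul_le_mul_of_nonneg_left k4 (by positivity : 0 ≤ 8 * K * Λ * k)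
    have hmn : 0 ≤ m (x (i + 1)) := layerPrimitive_nonneg hε hmem.1
    have k6 : 6 * K * Λ ≤ b / k * ((6 * K * Λ * A + 8 * K * Λ * m (x (i + 1))) * k) := by
      have hbA : 1 ≤ b * A := by
        calc (1 : ℝ) = A⁻¹ * A := (inv_mul_cancel₀ hA.ne').symm
          _ ≤ b * A := mul_le_mul_of_nonneg_right hb hA.le
      have : b / k * ((6 * K * Λ * A + 8 * K * Λ * m (x (i + 1))) * k)
          = 6 * K * Λ * (b * A) + 8 * K * Λ * m (x (i + 1)) * b := by field_simp
      rw [this]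
      have := mul_le_mul_of_nonneg_left hbA (by positivity : 0 ≤ 6 * K * Λ)
      have : 0 ≤ 8 * K * Λ * m (x (i + 1)) * b := by positivity
      linarith
    linarith

/-- The second discrete time derivative is bounded, uniformly in `ε` and in the mesh. -/
theorem IsUpwindSolution.exists_abs_timeDiff_timeDiff_le (hL : 0 < L) (hT : 0 < T) (hα : 0 < α)
    (hA : 0 < A) (hΛ : 0 < Λ) (hK : 0 ≤ K) (hv : VelocityBounds L T α A Λ a) :
    ∃ C, 0 ≤ C ∧ ∀ (ε : ℝ) (f : ℝ → ℝ) (N M : ℕ) (x : ℕ → ℝ) (W : ℕ → ℕ → ℝ), 0 < ε →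
      IsLayerForcing L K ε f → IsMesh L N x → IsMesh T M (uniformNode T M) →
      IsUpwindSolution a f N M x (uniformNode T M) W → ∀ i ≤ N, ∀ j < M,
      |(timeDiff (T / M) W i (j + 1) - timeDiff (T / M) W i j) / (T / M)| ≤ C := by
  set Cp := 8 * K * Λ * (L + 2) * Real.exp (Λ * T / A⁻¹) with hCp
  have hCp0 : 0 ≤ Cp := by positivity
  refine ⟨(6 * K * Λ * A + (16 * K * Λ + Λ * Cp) * (L + 2)) * Real.exp (2 * Λ * T / A⁻¹),
    by positivity, fun ε f N M x W hε hf hx ht hW i hi j hj => ?_⟩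
  have hM : 1 ≤ M := by omega
  have hM' : (0 : ℝ) < M := by exact_mod_cast hM
  have hk : 0 < T / M := by positivity
  have hm0 : ∀ {i}, i ≤ N → 0 ≤ layerPrimitive ε (x i) :=
    fun h => layerPrimitive_nonneg hε (hx.mem h).1
  set P := timeDiff (T / M) W with hP
  have key := discrete_stability (N := N) (M := M - 1) (x := x)
    (G := fun i => 6 * K * Λ * A + (16 * K * Λ + Λ * Cp) * layerPrimitive ε (x i))
    (β := fun i j => (a (x i) (uniformNode T M (j + 1)))⁻¹)
    (Y := fun i j => (P i (j + 1) - P i j) / (T / M)) (k := T / M)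
    (c := 2 * Λ) (β₀ := A⁻¹) hk (by positivity) (inv_pos.2 hA) hx.lt
    (fun i hi j hj => (hv.inv_bounds hα (hx.mem hi) (ht.mem (by omega))).1)
    (fun i hi => by
      have h1 := layerPrimitive_sub (x := x i) (y := x (i + 1)) hε
      have h2 := sub_pos.2 (hx.lt i hi)
      have h3 := layerWeight_nonneg hε (x (i + 1))
      have : layerPrimitive ε (x i) ≤ layerPrimitive ε (x (i + 1)) := by nlinarith
      gcongr)
    (fun i hi => by
      have h := hW.abs_timeDiff_one_le hL hT hα hA hΛ hε hv hf hx ht hM hi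
      have e : P i 0 = 0 := rfl
      rw [zero_add, e, sub_zero, abs_div, abs_of_pos hk]
      refine h.trans ?_
      have := mul_nonneg (by positivity : 0 ≤ 8 * K * Λ + Λ * Cp) (hm0 hi)
      linarith)
    (fun j hj => by
      rw [hP, hW.timeDiff_inflow (by omega), hW.timeDiff_inflow (by omega), sub_zero, zero_div,
        abs_zero]
      exact add_nonneg (by positivity) (mul_nonneg (by positivity) (hm0 (Nat.zero_le _))))
    (fun i hi j hj => by
      have hmem := hx.mem (Nat.succ_le_of_lt hi)
      have e1 := hW.spaceDiff_timeDiff_eq hα hT hv hx ht hi (j := j + 1) (by omega)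
        (fun _ => rfl) hP
      have e0 := hW.spaceDiff_timeDiff_eq hα hT hv hx ht hi (j := j) (by omega) (fun _ => rfl) hP
      have d1 := hv.abs_timeDiff_inv_le hT ht hmem (j := j + 1) (by omega)
      have d0 := hv.abs_timeDiff_inv_le hT ht hmem (j := j) (by omega)
      have d2 := hv.abs_timeDiff_timeDiff_inv_le hT ht hmem (j := j) (by omega)
      have hF := hf.abs_le hL hε hmem
      have hPb := hW.abs_timeDiff_le hL hT hα hA hΛ hε hv hf hx ht (i := i + 1) (j := j + 1) hi
        (by omega)
      rw [← hP, ← hCp] at hPb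
      have hd := sub_pos.2 (hx.lt i hi)
      have hm := layerPrimitive_sub (x := x i) (y := x (i + 1)) hε
      simp only [Nat.succ_eq_add_one, add_assoc, Nat.reduceAdd] at *
      set b2 := (a (x (i + 1)) (uniformNode T M (j + 2)))⁻¹
      set b1 := (a (x (i + 1)) (uniformNode T M (j + 1)))⁻¹
      set b0 := (a (x (i + 1)) (uniformNode T M j))⁻¹
      set k := T / (M : ℝ)
      set R1 := (P (i + 1) (j + 2) - P (i + 1) (j + 1)) / k with hR1
      set R0 := (P (i + 1) (j + 1) - P (i + 1) j) / k with hR0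
      set μ := layerWeight ε (x (i + 1))
      have hμ : 0 ≤ μ := layerWeight_nonneg hε _
      have hR0' : P (i + 1) (j + 1) = P (i + 1) j + k * R0 := by rw [hR0]; field_simp; ring
      have e : b2 * ((R1 - R0) / k)
            + (R1 - (P i (j + 2) - P i (j + 1)) / k) / (x (i + 1) - x i)
          = (f (x (i + 1)) - P (i + 1) (j + 1)) * (((b2 - b1) / k - (b1 - b0) / k) / k)
            - R0 * ((b2 - b1) / k + (b1 - b0) / k) := by
        have e3 : (R1 - (P i (j + 2) - P i (j + 1)) / k) / (x (i + 1) - x i)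
            = ((P (i + 1) (j + 2) - P i (j + 2)) / (x (i + 1) - x i)
              - (P (i + 1) (j + 1) - P i (j + 1)) / (x (i + 1) - x i)) / k := by
          rw [hR1]; field_simp; ring
        rw [e3, e1, e0, hR0']
        field_simp
        ring
      rw [e]
      refine (abs_sub _ _).trans ?_
      rw [abs_mul, abs_mul]
      have a1 : |f (x (i + 1)) - P (i + 1) (j + 1)| ≤ 8 * K * μ + Cp :=
        (abs_sub _ _).trans (add_le_add hF hPb)
      have a2 : |(b2 - b1) / k + (b1 - b0) / k| ≤ 2 * Λ :=
        (abs_add_le _ _).trans (by linarith)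
      have a3 := mul_le_mul a1 d2 (abs_nonneg _) (by positivity)
      have a4 := mul_le_mul_of_nonneg_left a2 (abs_nonneg R0)
      have a5 : 1 + μ ≤ (layerPrimitive ε (x (i + 1)) - layerPrimitive ε (x i))
          / (x (i + 1) - x i) := by
        rw [le_div_iff₀ hd]; linarith
      have a6 := mul_le_mul_of_nonneg_left a5 (by positivity : 0 ≤ 16 * K * Λ + Λ * Cp)
      have a7 : 0 ≤ 8 * K * Λ * μ := by positivity
      have a8 : 0 ≤ Λ * Cp * μ := by positivity
      have a9 : 0 ≤ K * Λ := by positivity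
      have e4 : (6 * K * Λ * A + (16 * K * Λ + Λ * Cp) * layerPrimitive ε (x (i + 1))
          - (6 * K * Λ * A + (16 * K * Λ + Λ * Cp) * layerPrimitive ε (x i))) / (x (i + 1) - x i)
          = (16 * K * Λ + Λ * Cp) * ((layerPrimitive ε (x (i + 1)) - layerPrimitive ε (x i))
          / (x (i + 1) - x i)) := by ring
      simp only [e4] at *
      linarith) j (by omega) i hi
  refine key.trans (mul_le_mul (add_le_add_right (mul_le_mul_of_nonneg_left ?_ (by positivity)) _)
    (one_add_pow_le_exp (by positivity) hk.le (inv_pos.2 hA) (ht.mem hj.le).2) (by positivity)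
    (by positivity))
  exact (layerPrimitive_le ε _).trans (by linarith [(hx.mem hi).2])

/-- The space differences of the discrete solution and of its time derivative are bounded by a
multiple of `1 + layerWeight`, which is bounded in `L¹`. -/
theorem IsUpwindSolution.exists_abs_spaceDiff_le (hL : 0 < L) (hT : 0 < T) (hα : 0 < α)
    (hA : 0 < A) (hΛ : 0 < Λ) (hK : 0 ≤ K) (hv : VelocityBounds L T α A Λ a) :
    ∃ C, 0 ≤ C ∧ ∀ (ε : ℝ) (f : ℝ → ℝ) (N M : ℕ) (x : ℕ → ℝ) (W : ℕ → ℕ → ℝ), 0 < ε →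
      IsLayerForcing L K ε f → IsMesh L N x → IsMesh T M (uniformNode T M) →
      IsUpwindSolution a f N M x (uniformNode T M) W → ∀ i < N, ∀ j ≤ M,
      |(W (i + 1) j - W i j) / (x (i + 1) - x i)| ≤ C * (1 + layerWeight ε (x (i + 1))) ∧
      |(timeDiff (T / M) W (i + 1) j - timeDiff (T / M) W i j) / (x (i + 1) - x i)|
        ≤ C * (1 + layerWeight ε (x (i + 1))) := by
  obtain ⟨Cr, hCr, hR⟩ :=
    IsUpwindSolution.exists_abs_timeDiff_timeDiff_le hL hT hα hA hΛ hK hv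
  set Cp := 8 * K * Λ * (L + 2) * Real.exp (Λ * T / A⁻¹) with hCp
  have hCp0 : 0 ≤ Cp := by positivity
  refine ⟨(8 * K + Cp) * (α⁻¹ + Λ) + α⁻¹ * Cr, by positivity,
    fun ε f N M x W hε hf hx ht hW i hi j hj => ?_⟩
  have hmem := hx.mem (Nat.succ_le_of_lt hi)
  have hF := hf.abs_le hL hε hmem
  have hμ := layerWeight_nonneg hε (x (i + 1))
  have hfP : ∀ j ≤ M, |f (x (i + 1)) - timeDiff (T / M) W (i + 1) j|
      ≤ (8 * K + Cp) * (1 + layerWeight ε (x (i + 1))) := fun j hj => by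
    have := hW.abs_timeDiff_le hL hT hα hA hΛ hε hv hf hx ht (i := i + 1) hi hj
    have h1 := mul_nonneg hCp0 hμ
    refine (abs_sub _ _).trans ?_
    rw [← hCp] at this
    linarith
  have hb : ∀ j ≤ M, |(a (x (i + 1)) (uniformNode T M j))⁻¹| ≤ α⁻¹ := fun j hj => by
    have h := hv.inv_bounds hα hmem (ht.mem hj)
    rw [abs_of_pos ((inv_pos.2 hA).trans_le h.1)]
    exact h.2
  set w := 1 + layerWeight ε (x (i + 1)) with hw
  have hw1 : 1 ≤ w := by linarith
  have p1 : 0 ≤ (8 * K + Cp) * Λ * w := by positivity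
  have p2 : 0 ≤ (8 * K + Cp) * α⁻¹ * w := by positivity
  have p3 : 0 ≤ α⁻¹ * Cr := by positivity
  have p4 : α⁻¹ * Cr ≤ α⁻¹ * Cr * w := le_mul_of_one_le_right p3 hw1
  constructor
  · rw [hW.spaceDiff_eq hα hv hx ht hi hj, abs_mul]
    have := mul_le_mul (hb j hj) (hfP j hj) (abs_nonneg _) (by positivity)
    linarith
  · cases j with
    | zero =>
      simp only [timeDiff, sub_self, zero_div, abs_zero]
      positivity
    | succ j =>
      rw [hW.spaceDiff_timeDiff_eq hα hT hv hx ht hi hj (fun _ => rfl) rfl]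
      refine (abs_sub _ _).trans ?_
      rw [abs_mul, abs_mul]
      have h1 := mul_le_mul (hfP j (by omega)) (hv.abs_timeDiff_inv_le hT ht hmem hj)
        (abs_nonneg _) (by positivity)
      have h2 := mul_le_mul (hb (j + 1) hj) (hR ε f N M x W hε hf hx ht hW (i + 1) hi j hj)
        (abs_nonneg _) (by positivity)
      linarith

end DiscreteBounds

/-! ### A comparison principle for piecewise smooth functions -/

theorem left_deriv_nonneg_of_forall_le {g : ℝ → ℝ} {g' p x : ℝ} (hp : p < x)
    (hg : HasDerivWithinAt g g' (Icc p x) x) (h : ∀ y ∈ Icc p x, g y ≤ g x) : 0 ≤ g' := by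
  have hloc : IsLocalMaxOn g (Icc p x) x := Filter.eventually_of_mem self_mem_nhdsWithin h
  have h1 := hloc.hasFDerivWithinAt_nonpos hg.hasFDerivWithinAt
    (sub_mem_posTangentConeAt_of_segment_subset
      ((convex_Icc p x).segment_subset ⟨hp.le, le_rfl⟩ ⟨le_rfl, hp.le⟩))
  simp only [ContinuousLinearMap.toSpanSingleton_apply, smul_eq_mul] at h1
  nlinarith

theorem nonpos_of_left_deriv_neg {p q : ℝ} {E : ℝ → ℝ} (hE : ContinuousOn E (Icc p q))
    (hp : E p ≤ 0) (h : ∀ x ∈ Ioc p q, ∃ E', HasDerivWithinAt E E' (Icc p x) x ∧ E' < 0) :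
    ∀ x ∈ Icc p q, E x ≤ 0 := by
  intro y hy
  obtain ⟨x, hx, hmax⟩ := isCompact_Icc.exists_isMaxOn ⟨y, hy⟩ hE
  refine (hmax hy).trans ?_
  obtain rfl | hpx := hx.1.eq_or_lt
  · exact hp
  obtain ⟨E', hd, hneg⟩ := h x ⟨hpx, hx.2⟩
  exact absurd (left_deriv_nonneg_of_forall_le hpx hd fun z hz => hmax ⟨hz.1, hz.2.trans hx.2⟩)
    hneg.not_ge

/-- Comparison principle for the transport operator on a rectangle: at a maximum away from the
left and bottom sides both left derivatives are nonnegative. -/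
theorem nonpos_of_transport_neg {p q r s : ℝ} {E : ℝ → ℝ → ℝ}
    (hE : ContinuousOn (fun z : ℝ × ℝ => E z.1 z.2) (Icc p q ×ˢ Icc r s))
    (hl : ∀ t ∈ Icc r s, E p t ≤ 0) (hb : ∀ x ∈ Icc p q, E x r ≤ 0)
    (h : ∀ x ∈ Ioc p q, ∀ t ∈ Ioc r s, ∃ c Ex Et, 0 ≤ c ∧
      HasDerivWithinAt (fun y => E y t) Ex (Icc p x) x ∧
      HasDerivWithinAt (fun τ => E x τ) Et (Icc r t) t ∧ Et + c * Ex < 0) :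
    ∀ x ∈ Icc p q, ∀ t ∈ Icc r s, E x t ≤ 0 := by
  intro y hy τ hτ
  obtain ⟨⟨x, t⟩, ⟨hx, ht⟩, hmax⟩ :=
    (isCompact_Icc.prod isCompact_Icc).exists_isMaxOn ⟨(y, τ), hy, hτ⟩ hE
  refine (hmax (⟨hy, hτ⟩ : (y, τ) ∈ Icc p q ×ˢ Icc r s)).trans ?_
  simp only at hx ht ⊢
  obtain rfl | hpx := hx.1.eq_or_lt
  · exact hl t ht
  obtain rfl | hrt := ht.1.eq_or_lt
  · exact hb x hx
  obtain ⟨c, Ex, Et, hc, hdx, hdt, hneg⟩ := h x ⟨hpx, hx.2⟩ t ⟨hrt, ht.2⟩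
  have h1 := left_deriv_nonneg_of_forall_le hpx hdx fun z hz =>
    hmax (⟨⟨hz.1, hz.2.trans hx.2⟩, ht⟩ : (z, t) ∈ Icc p q ×ˢ Icc r s)
  have h2 := left_deriv_nonneg_of_forall_le hrt hdt fun z hz =>
    hmax (⟨hx, hz.1, hz.2.trans ht.2⟩ : (x, z) ∈ Icc p q ×ˢ Icc r s)
  exact absurd (add_nonneg h2 (mul_nonneg hc h1)) hneg.not_ge

theorem IsMesh.exists_cell {L : ℝ} {N : ℕ} {x : ℕ → ℝ} (hx : IsMesh L N x) (hN : 0 < N) {y : ℝ}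
    (hy : y ∈ Icc 0 L) : ∃ i < N, y ∈ Icc (x i) (x (i + 1)) := by
  classical
  have hex : ∃ i, y ≤ x (i + 1) := ⟨N - 1, by rw [Nat.sub_add_cancel hN, hx.last]; exact hy.2⟩
  have hlt : Nat.find hex ≤ N - 1 :=
    Nat.find_min' hex (by rw [Nat.sub_add_cancel hN, hx.last]; exact hy.2)
  refine ⟨Nat.find hex, by omega, ?_, Nat.find_spec hex⟩
  cases h : Nat.find hex with
  | zero => rw [hx.zero]; exact hy.1
  | succ i => exact (not_le.1 (Nat.find_min hex (by omega : i < Nat.find hex))).le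

/-- Comparison principle for the transport operator, for functions that are smooth on the cells of
a mesh. The initial line plays the role of a one-dimensional problem. -/
theorem nonpos_of_transport_neg_on_cells {L T : ℝ} {N M : ℕ} {x t : ℕ → ℝ} {E : ℝ → ℝ → ℝ}
    (hN : 0 < N) (hM : 0 < M) (hx : IsMesh L N x) (ht : IsMesh T M t)
    (hE : ∀ i < N, ∀ j < M, ContinuousOn (fun z : ℝ × ℝ => E z.1 z.2)
      (Icc (x i) (x (i + 1)) ×ˢ Icc (t j) (t (j + 1))))
    (hl : ∀ s ∈ Icc 0 T, E 0 s ≤ 0)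
    (hb : ∀ i < N, ∀ y ∈ Ioc (x i) (x (i + 1)), ∃ E',
      HasDerivWithinAt (fun y => E y 0) E' (Icc (x i) y) y ∧ E' < 0)
    (h : ∀ i < N, ∀ j < M, ∀ y ∈ Ioc (x i) (x (i + 1)), ∀ s ∈ Ioc (t j) (t (j + 1)),
      ∃ c Ex Et, 0 ≤ c ∧ HasDerivWithinAt (fun y => E y s) Ex (Icc (x i) y) y ∧
        HasDerivWithinAt (fun τ => E y τ) Et (Icc (t j) s) s ∧ Et + c * Ex < 0) :
    ∀ y ∈ Icc 0 L, ∀ s ∈ Icc 0 T, E y s ≤ 0 := by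
  have bottom : ∀ i < N, ∀ y ∈ Icc (x i) (x (i + 1)), E y 0 ≤ 0 := by
    intro i
    induction i with
    | zero =>
      intro hi
      refine nonpos_of_left_deriv_neg ?_ (hx.zero ▸ hl 0 ⟨le_rfl, ?_⟩) (hb 0 hi)
      · exact (hE 0 hi 0 hM).comp (continuous_id.prodMk continuous_const).continuousOn
          fun y hy => ⟨hy, ht.zero.le, ht.zero ▸ (ht.lt 0 hM).le⟩
      · exact (ht.mem le_rfl).1.trans ht.last.le
    | succ i ih =>
      intro hi
      refine nonpos_of_left_deriv_neg ?_ (ih (by omega) _ ⟨(hx.lt i (by omega)).le, le_rfl⟩)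
        (hb _ hi)
      exact (hE _ hi 0 hM).comp (continuous_id.prodMk continuous_const).continuousOn
        fun y hy => ⟨hy, ht.zero.le, ht.zero ▸ (ht.lt 0 hM).le⟩
  have cells : ∀ j < M, ∀ i < N, ∀ y ∈ Icc (x i) (x (i + 1)), ∀ s ∈ Icc (t j) (t (j + 1)),
      E y s ≤ 0 := by
    intro j
    induction j with
    | zero =>
      intro hj i
      induction i with
      | zero =>
        intro hi
        refine nonpos_of_transport_neg (hE 0 hi 0 hj) (fun s hs => ?_)
          (ht.zero.symm ▸ bottom 0 hi) (h 0 hi 0 hj)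
        exact hx.zero.symm ▸ hl s ⟨(ht.mem hj.le).1.trans hs.1, hs.2.trans (ht.mem hj).2⟩
      | succ i ih =>
        intro hi
        exact nonpos_of_transport_neg (hE _ hi 0 hj)
          (ih (by omega) _ ⟨(hx.lt i (by omega)).le, le_rfl⟩) (ht.zero.symm ▸ bottom _ hi)
          (h _ hi 0 hj)
    | succ j ihj =>
      intro hj i
      have hbot : ∀ i < N, ∀ y ∈ Icc (x i) (x (i + 1)), E y (t (j + 1)) ≤ 0 := fun i hi y hy =>
        ihj (by omega) i hi y hy _ ⟨(ht.lt j (by omega)).le, le_rfl⟩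
      induction i with
      | zero =>
        intro hi
        refine nonpos_of_transport_neg (hE 0 hi _ hj) (fun s hs => ?_) (hbot 0 hi) (h 0 hi _ hj)
        exact hx.zero.symm ▸ hl s ⟨(ht.mem hj.le).1.trans hs.1, hs.2.trans (ht.mem hj).2⟩
      | succ i ih =>
        intro hi
        exact nonpos_of_transport_neg (hE _ hi _ hj)
          (ih (by omega) _ ⟨(hx.lt i (by omega)).le, le_rfl⟩) (hbot _ hi) (h _ hi _ hj)
  intro y hy s hs
  obtain ⟨i, hi, hyi⟩ := hx.exists_cell hN hy
  obtain ⟨j, hj, hsj⟩ := ht.exists_cell hM hs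
  exact cells j hj i hi y hyi s hsj

/-! ### The bilinear interpolant on a cell -/

theorem hat_right {n : ℕ} {z : ℕ → ℝ} {i : ℕ} {y : ℝ} (hy : y ∈ Icc (z i) (z (i + 1))) :
    hat n z (i + 1) y = (y - z i) / (z (i + 1) - z i) := by
  unfold hat
  rw [if_pos ⟨by omega, hy⟩]
  rfl

theorem IsMesh.hat_left {L : ℝ} {n : ℕ} {z : ℕ → ℝ} (hz : IsMesh L n z) {i : ℕ} (hi : i < n)
    {y : ℝ} (hy : y ∈ Icc (z i) (z (i + 1))) :
    hat n z i y = (z (i + 1) - y) / (z (i + 1) - z i) := by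
  unfold hat
  split_ifs with h1 h2
  · obtain rfl : y = z i := le_antisymm h1.2.2 hy.1
    have h3 := hz.lt (i - 1) (by omega)
    rw [Nat.sub_add_cancel h1.1] at h3
    rw [div_self (sub_pos.2 h3).ne', div_self (sub_pos.2 (hz.lt i hi)).ne']
  · rfl
  · exact absurd ⟨hi, hy⟩ h2

theorem IsMesh.hat_eq_zero {L : ℝ} {n : ℕ} {z : ℕ → ℝ} (hz : IsMesh L n z) {i l : ℕ}
    (hi : i < n) (hl : l ≤ n) (h1 : l ≠ i) (h2 : l ≠ i + 1) {y : ℝ}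
    (hy : y ∈ Icc (z i) (z (i + 1))) : hat n z l y = 0 := by
  unfold hat
  -- the closed supports meet the cell in its end points at most, where the hat function vanishes
  rcases Nat.lt_or_gt_of_ne h1 with h | h
  · have h3 : z (l + 1) ≤ z i := hz.mono h hi.le
    have h4 := hz.lt l (by omega)
    split_ifs with h5 h6
    · linarith [h5.2.2, hy.1]
    · rw [le_antisymm h6.2.2 (h3.trans hy.1), sub_self, zero_div]
    · rfl
  · have h3 : z (i + 1) ≤ z (l - 1) := hz.mono (by omega) (by omega)
    have h4 := hz.lt (l - 1) (by omega)
    rw [Nat.sub_add_cancel (by omega)] at h4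
    split_ifs with h5 h6
    · rw [le_antisymm (hy.2.trans h3) h5.2.1, sub_self, zero_div]
    · linarith [h6.2.1, hy.2]
    · rfl

theorem IsMesh.sum_mul_hat {L : ℝ} {n : ℕ} {z : ℕ → ℝ} (hz : IsMesh L n z) {i : ℕ} (hi : i < n)
    {y : ℝ} (hy : y ∈ Icc (z i) (z (i + 1))) (c : ℕ → ℝ) :
    ∑ l ∈ Finset.range (n + 1), c l * hat n z l y
      = c i * ((z (i + 1) - y) / (z (i + 1) - z i))
        + c (i + 1) * ((y - z i) / (z (i + 1) - z i)) := by
  rw [← hz.hat_left hi hy, ← hat_right (n := n) hy]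
  refine Finset.sum_eq_add i (i + 1) (by omega) (fun l hl hne => ?_) (fun h => ?_) (fun h => ?_)
  · rw [hz.hat_eq_zero hi (by have := Finset.mem_range.1 hl; omega) hne.1 hne.2 hy, mul_zero]
  · exact absurd (Finset.mem_range.2 (by omega)) h
  · exact absurd (Finset.mem_range.2 (by omega)) h

/-- The bilinear function on the cell `[x i, x (i + 1)] × [t j, t (j + 1)]` with the values of `W`
at the corners. -/
noncomputable def cellInterpolant (x t : ℕ → ℝ) (W : ℕ → ℕ → ℝ) (i j : ℕ) (y s : ℝ) : ℝ :=
  (W i j * ((t (j + 1) - s) / (t (j + 1) - t j))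
      + W i (j + 1) * ((s - t j) / (t (j + 1) - t j))) * ((x (i + 1) - y) / (x (i + 1) - x i))
    + (W (i + 1) j * ((t (j + 1) - s) / (t (j + 1) - t j))
      + W (i + 1) (j + 1) * ((s - t j) / (t (j + 1) - t j))) * ((y - x i) / (x (i + 1) - x i))

theorem interpolant_eq_cellInterpolant {L T : ℝ} {N M : ℕ} {x t : ℕ → ℝ} (hx : IsMesh L N x)
    (ht : IsMesh T M t) (W : ℕ → ℕ → ℝ) {i j : ℕ} (hi : i < N) (hj : j < M) {y s : ℝ}
    (hy : y ∈ Icc (x i) (x (i + 1))) (hs : s ∈ Icc (t j) (t (j + 1))) :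
    interpolant N M x t W y s = cellInterpolant x t W i j y s := by
  have h : interpolant N M x t W y s = ∑ l ∈ Finset.range (N + 1),
      (∑ m ∈ Finset.range (M + 1), W l m * hat M t m s) * hat N x l y := by
    unfold interpolant
    refine Finset.sum_congr rfl fun l _ => ?_
    rw [Finset.sum_mul]
    exact Finset.sum_congr rfl fun m _ => by ring
  rw [h, hx.sum_mul_hat hi hy, ht.sum_mul_hat hj hs, ht.sum_mul_hat hj hs]
  rfl

theorem continuous_cellInterpolant (x t : ℕ → ℝ) (W : ℕ → ℕ → ℝ) (i j : ℕ) :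
    Continuous fun z : ℝ × ℝ => cellInterpolant x t W i j z.1 z.2 := by
  unfold cellInterpolant
  fun_prop

theorem hasDerivAt_cellInterpolant_fst (x t : ℕ → ℝ) (W : ℕ → ℕ → ℝ) (i j : ℕ) (y s : ℝ) :
    HasDerivAt (fun y => cellInterpolant x t W i j y s)
      ((W (i + 1) j - W i j) / (x (i + 1) - x i) * ((t (j + 1) - s) / (t (j + 1) - t j))
        + (W (i + 1) (j + 1) - W i (j + 1)) / (x (i + 1) - x i)
          * ((s - t j) / (t (j + 1) - t j))) y := by
  unfold cellInterpolant
  have h1 := ((hasDerivAt_id y).const_sub (x (i + 1))).div_const (x (i + 1) - x i)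
  have h2 := ((hasDerivAt_id y).sub_const (x i)).div_const (x (i + 1) - x i)
  refine ((h1.const_mul _).add (h2.const_mul _)).congr_deriv ?_
  ring

theorem hasDerivAt_cellInterpolant_snd (x t : ℕ → ℝ) (W : ℕ → ℕ → ℝ) (i j : ℕ) (y s : ℝ) :
    HasDerivAt (fun s => cellInterpolant x t W i j y s)
      ((W i (j + 1) - W i j) / (t (j + 1) - t j) * ((x (i + 1) - y) / (x (i + 1) - x i))
        + (W (i + 1) (j + 1) - W (i + 1) j) / (t (j + 1) - t j)
          * ((y - x i) / (x (i + 1) - x i))) s := by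
  unfold cellInterpolant
  have h1 := ((hasDerivAt_id s).const_sub (t (j + 1))).div_const (t (j + 1) - t j)
  have h2 := ((hasDerivAt_id s).sub_const (t j)).div_const (t (j + 1) - t j)
  refine ((((h1.const_mul (W i j)).add (h2.const_mul (W i (j + 1)))).mul_const _).add
    (((h1.const_mul (W (i + 1) j)).add (h2.const_mul (W (i + 1) (j + 1)))).mul_const _)).congr_deriv
      ?_
  ring

/-! ### The Shishkin mesh -/

theorem shishkinNode_isMesh {L ε : ℝ} (hL : 0 < L) (hε : 0 < ε) {N : ℕ} (hN : 2 ≤ N)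
    (hNe : Even N) :
    IsMesh L N (shishkinNode L ε N) ∧
      ∀ i < N, shishkinNode L ε N (i + 1) - shishkinNode L ε N i ≤ 2 * L / N := by
  obtain ⟨n, rfl⟩ := hNe
  have hn : 0 < n := by omega
  have hn' : (0 : ℝ) < n := by exact_mod_cast hn
  have hlog : 0 < Real.log ((n + n : ℕ) : ℝ) := Real.log_pos (by exact_mod_cast hN)
  have hσ : 0 < transitionPoint L ε (n + n) := lt_min (by linarith) (mul_pos hε hlog)
  have hσL : transitionPoint L ε (n + n) ≤ L / 2 := min_le_left _ _
  set σ := transitionPoint L ε (n + n)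
  have hdiv : (n + n) / 2 = n := by omega
  have hleft : ∀ i ≤ n, shishkinNode L ε (n + n) i = i * (σ / n) := fun i hi => by
    rw [shishkinNode, if_pos (by omega)]
    push_cast
    field_simp
    ring
  have hright : ∀ i, n ≤ i → shishkinNode L ε (n + n) i = σ + (i - n) * ((L - σ) / n) := by
    intro i hi
    obtain rfl | hlt := hi.eq_or_lt
    · rw [hleft n le_rfl]
      field_simp
      ring
    · rw [shishkinNode, if_neg (by omega)]
      push_cast
      field_simp
      ring
  have hstep : ∀ i, shishkinNode L ε (n + n) (i + 1) - shishkinNode L ε (n + n) i = σ / n ∨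
      shishkinNode L ε (n + n) (i + 1) - shishkinNode L ε (n + n) i = (L - σ) / n := fun i => by
    rcases Nat.lt_or_ge i n with h | h
    · left
      rw [hleft _ h, hleft _ h.le]
      push_cast
      ring
    · right
      rw [hright _ h, hright _ (by omega)]
      push_cast
      ring
  refine ⟨⟨by simp [hleft 0 hn.le], fun i _ => sub_pos.1 ?_, ?_⟩, fun i _ => ?_⟩
  · rcases hstep i with h | h <;> rw [h]
    · positivity
    · exact div_pos (by linarith) hn'
  · rw [hright _ (by omega)]
    push_cast
    field_simp
    ring
  · have e : 2 * L / ((n + n : ℕ) : ℝ) = L / n := by push_cast; field_simp; ring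
    rw [e]
    rcases hstep i with h | h <;> rw [h] <;> gcongr <;> linarith

/-! ### The residual of the interpolant -/

section Residual

variable {L T α A Λ K ε C H : ℝ} {a : ℝ → ℝ → ℝ} {f : ℝ → ℝ} {N M : ℕ} {x : ℕ → ℝ}
  {W : ℕ → ℕ → ℝ}

/-- The algebra behind `abs_residual_le`: `V` and `P` are the difference quotients of the discrete
solution at the upper right corner of an `h × k` cell, where the scheme `P + ai V = fi` holds, and
`Q` is its mixed difference quotient. -/
theorem abs_residual_le_aux {V Q P as ai fi fy ξ θ h k w : ℝ} (hξ : 0 ≤ ξ) (hξ' : ξ ≤ 1)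
    (hθ : 0 ≤ θ) (hθ' : θ ≤ 1) (hh : 0 ≤ h) (hk : 0 ≤ k) (hC : 0 ≤ C) (hΛ : 0 ≤ Λ) (hw : 0 ≤ w)
    (has : 0 ≤ as) (hasA : as ≤ A) (hai : |as - ai| ≤ Λ * (h + k)) (hV : |V| ≤ C * w)
    (hQ : |Q| ≤ C * w) (hf : |fi - fy| ≤ 2 * K * w * h) (hK : 0 ≤ K) (heq : P + ai * V = fi) :
    |(P - (1 - ξ) * h * Q) + as * (V - (1 - θ) * k * Q) - fy|
      ≤ (C * (1 + Λ + A) + 2 * K) * (h + k) * w := by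
  have e : (P - (1 - ξ) * h * Q) + as * (V - (1 - θ) * k * Q) - fy
      = (fi - fy) + (as - ai) * V - ((1 - ξ) * h + as * (1 - θ) * k) * Q := by
    rw [← heq]; ring
  rw [e]
  have h1 : |(as - ai) * V| ≤ Λ * (h + k) * (C * w) := by
    rw [abs_mul]
    exact mul_le_mul hai hV (abs_nonneg _) (by positivity)
  have h3 : 0 ≤ (1 - ξ) * h + as * (1 - θ) * k :=
    add_nonneg (mul_nonneg (by linarith) hh) (mul_nonneg (mul_nonneg has (by linarith)) hk)
  have h4 : (1 - ξ) * h + as * (1 - θ) * k ≤ h + A * k := by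
    have g1 : (1 - ξ) * h ≤ h := by nlinarith
    have g2 : as * (1 - θ) ≤ A := by nlinarith
    have g3 := mul_le_mul_of_nonneg_right g2 hk
    linarith
  have h2 : |((1 - ξ) * h + as * (1 - θ) * k) * Q| ≤ (h + A * k) * (C * w) := by
    rw [abs_mul, abs_of_nonneg h3]
    exact mul_le_mul h4 hQ (abs_nonneg _) (h3.trans h4)
  have hA : 0 ≤ A := has.trans hasA
  have p1 : 0 ≤ C * w * k := by positivity
  have p2 : 0 ≤ A * (C * w * h) := by positivity
  have p3 : 0 ≤ K * w * k := by positivity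
  refine (abs_sub _ _).trans ((add_le_add_left (abs_add_le _ _) _).trans ?_)
  linarith

/-- The residual of the bilinear interpolant in the transport equation, on a single cell. The
one-sided evaluation of the scheme at the upper right corner produces an error of first order. -/
theorem IsUpwindSolution.abs_residual_le (hL : 0 < L) (hα : 0 < α) (hΛ : 0 < Λ)
    (hε : 0 < ε) (hv : VelocityBounds L T α A Λ a) (hf : IsLayerForcing L K ε f)
    (hx : IsMesh L N x) (ht : IsMesh T M (uniformNode T M))
    (hW : IsUpwindSolution a f N M x (uniformNode T M) W) (hC : 0 ≤ C)
    (hD : ∀ i < N, ∀ j ≤ M,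
      |(W (i + 1) j - W i j) / (x (i + 1) - x i)| ≤ C * (1 + layerWeight ε (x (i + 1))) ∧
      |(timeDiff (T / M) W (i + 1) j - timeDiff (T / M) W i j) / (x (i + 1) - x i)|
        ≤ C * (1 + layerWeight ε (x (i + 1))))
    (hH : ∀ i < N, x (i + 1) - x i ≤ H) {t : ℕ → ℝ} (hte : t = uniformNode T M) {i j : ℕ}
    (hi : i < N) (hj : j < M) {y s : ℝ}
    (hy : y ∈ Icc (x i) (x (i + 1))) (hs : s ∈ Icc (t j) (t (j + 1))) :
    |((W i (j + 1) - W i j) / (t (j + 1) - t j) * ((x (i + 1) - y) / (x (i + 1) - x i))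
        + (W (i + 1) (j + 1) - W (i + 1) j) / (t (j + 1) - t j)
          * ((y - x i) / (x (i + 1) - x i)))
      + a y s * ((W (i + 1) j - W i j) / (x (i + 1) - x i) * ((t (j + 1) - s) / (t (j + 1) - t j))
        + (W (i + 1) (j + 1) - W i (j + 1)) / (x (i + 1) - x i)
          * ((s - t j) / (t (j + 1) - t j))) - f y|
      ≤ (C * (1 + Λ + A) + 2 * K) * (H + T / M) * (1 + layerWeight ε y) := by
  have hM : (0 : ℝ) < M := by exact_mod_cast (Nat.zero_le _).trans_lt hj
  rw [← hte] at ht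
  have htk : t (j + 1) - t j = T / M := by rw [hte, uniformNode_succ, add_sub_cancel_left]
  have hk : 0 < t (j + 1) - t j := sub_pos.2 (ht.lt j hj)
  have hh : 0 < x (i + 1) - x i := sub_pos.2 (hx.lt i hi)
  have hx1 := hx.mem (Nat.succ_le_of_lt hi)
  have ht1 := ht.mem (Nat.succ_le_of_lt hj)
  have hyL : y ∈ Icc 0 L := ⟨(hx.mem hi.le).1.trans hy.1, hy.2.trans hx1.2⟩
  have hsT : s ∈ Icc 0 T := ⟨(ht.mem hj.le).1.trans hs.1, hs.2.trans ht1.2⟩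
  have hK := hf.const_nonneg hL hε
  have hμ := layerWeight_nonneg hε y
  have hw : C * (1 + layerWeight ε (x (i + 1))) ≤ C * (1 + layerWeight ε y) :=
    mul_le_mul_of_nonneg_left (by linarith [layerWeight_anti hε hy.2]) hC
  obtain ⟨hV, hQ⟩ := hD i hi (j + 1) hj
  have hscheme := hW.spaceDiff_eq hα hv hx (hte ▸ ht) hi (j := j + 1) hj
  have ha1 := (hα.trans_le (hv.lower _ hx1 _ ht1)).ne'
  rw [← hte, eq_inv_mul_iff_mul_eq₀ ha1] at hscheme
  have hF := hf.abs_sub_le hL hε hyL.1 hy.2 hx1.2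
  have hF' : |f (x (i + 1)) - f y|
      ≤ 2 * K * (1 + layerWeight ε y) * (x (i + 1) - x i) :=
    hF.trans (mul_le_mul (by linarith) (by linarith [hy.1]) (by linarith [hy.2]) (by positivity))
  have hlip := hv.lipschitz _ hyL _ hsT _ hx1 _ ht1
  have hlip' : |a y s - a (x (i + 1)) (t (j + 1))|
      ≤ Λ * ((x (i + 1) - x i) + (t (j + 1) - t j)) := by
    refine hlip.trans (mul_le_mul_of_nonneg_left (add_le_add ?_ ?_) hΛ.le)
    · rw [abs_le]; constructor <;> linarith [hy.1, hy.2]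
    · rw [abs_le]; constructor <;> linarith [hs.1, hs.2]
  have haux := abs_residual_le_aux (ξ := (y - x i) / (x (i + 1) - x i))
    (θ := (s - t j) / (t (j + 1) - t j))
    (div_nonneg (by linarith [hy.1]) hh.le) ((div_le_one hh).2 (by linarith [hy.2]))
    (div_nonneg (by linarith [hs.1]) hk.le) ((div_le_one hk).2 (by linarith [hs.2]))
    hh.le hk.le hC hΛ.le (by positivity) (hα.le.trans (hv.lower _ hyL _ hsT)) (hv.upper _ hyL _ hsT)
    hlip' (hV.trans hw) (hQ.trans hw) hF' hK
    (P := timeDiff (T / M) W (i + 1) (j + 1)) (by rw [hscheme]; ring)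
  refine (le_of_eq ?_).trans (haux.trans ?_)
  · simp only [timeDiff, ← htk]
    congr 1
    field_simp
    ring
  · have := hH i hi
    have hA : 0 ≤ A := (hα.le.trans (hv.lower _ hyL _ hsT)).trans (hv.upper _ hyL _ hsT)
    rw [← htk]
    gcongr

theorem IsUpwindSolution.abs_initial_residual_le (hL : 0 < L) (hT : 0 < T) (hα : 0 < α)
    (hΛ : 0 < Λ) (hε : 0 < ε) (hv : VelocityBounds L T α A Λ a) (hf : IsLayerForcing L K ε f)
    (hx : IsMesh L N x) (ht : IsMesh T M (uniformNode T M))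
    (hW : IsUpwindSolution a f N M x (uniformNode T M) W) (hC : 0 ≤ C)
    (hD : ∀ i < N, ∀ j ≤ M,
      |(W (i + 1) j - W i j) / (x (i + 1) - x i)| ≤ C * (1 + layerWeight ε (x (i + 1))) ∧
      |(timeDiff (T / M) W (i + 1) j - timeDiff (T / M) W i j) / (x (i + 1) - x i)|
        ≤ C * (1 + layerWeight ε (x (i + 1))))
    (hH : ∀ i < N, x (i + 1) - x i ≤ H) {i : ℕ} (hi : i < N) {y : ℝ}
    (hy : y ∈ Icc (x i) (x (i + 1))) :
    |a y 0 * ((W (i + 1) 0 - W i 0) / (x (i + 1) - x i)) - f y|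
      ≤ (C * (1 + Λ + A) + 2 * K) * (H + T / M) * (1 + layerWeight ε y) := by
  have hh : 0 < x (i + 1) - x i := sub_pos.2 (hx.lt i hi)
  have hx1 := hx.mem (Nat.succ_le_of_lt hi)
  have h0T : (0 : ℝ) ∈ Icc 0 T := ⟨le_rfl, hT.le⟩
  have hyL : y ∈ Icc 0 L := ⟨(hx.mem hi.le).1.trans hy.1, hy.2.trans hx1.2⟩
  have hK := hf.const_nonneg hL hε
  have hμ := layerWeight_nonneg hε y
  have hw : C * (1 + layerWeight ε (x (i + 1))) ≤ C * (1 + layerWeight ε y) :=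
    mul_le_mul_of_nonneg_left (by linarith [layerWeight_anti hε hy.2]) hC
  obtain ⟨hV, -⟩ := hD i hi 0 (Nat.zero_le _)
  have hscheme := hW.spaceDiff_eq hα hv hx ht hi (j := 0) (Nat.zero_le _)
  have ha1 := (hα.trans_le (hv.lower _ hx1 _ h0T)).ne'
  rw [ht.zero, eq_inv_mul_iff_mul_eq₀ ha1, timeDiff, sub_zero] at hscheme
  have hF := hf.abs_sub_le hL hε hyL.1 hy.2 hx1.2
  have hF' : |f (x (i + 1)) - f y|
      ≤ 2 * K * (1 + layerWeight ε y) * (x (i + 1) - x i) :=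
    hF.trans (mul_le_mul (by linarith) (by linarith [hy.1]) (by linarith [hy.2]) (by positivity))
  have hlip' : |a y 0 - a (x (i + 1)) 0| ≤ Λ * ((x (i + 1) - x i) + 0) := by
    refine (hv.lipschitz _ hyL _ h0T _ hx1 _ h0T).trans
      (mul_le_mul_of_nonneg_left (add_le_add ?_ ?_) hΛ.le)
    · rw [abs_le]; constructor <;> linarith [hy.1, hy.2]
    · simp
  have haux := abs_residual_le_aux (ξ := 1) (θ := 1) (Q := 0) (P := 0) (k := 0)
    zero_le_one le_rfl zero_le_one le_rfl
    hh.le le_rfl hC hΛ.le (by positivity) (hα.le.trans (hv.lower _ hyL _ h0T))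
    (hv.upper _ hyL _ h0T) hlip' (hV.trans hw) (by rw [abs_zero]; positivity) hF' hK (by rw [hscheme]; ring)
  refine (le_of_eq ?_).trans (haux.trans ?_)
  · congr 1
    ring
  · have := hH i hi
    have hA : 0 ≤ A := (hα.le.trans (hv.lower _ hyL _ h0T)).trans (hv.upper _ hyL _ h0T)
    have : 0 ≤ T / M := by positivity
    gcongr

end Residual

/-! ### The error estimate -/

theorem IsLayerSolution.hasDerivWithinAt_fst {L T : ℝ} {a : ℝ → ℝ → ℝ} {f : ℝ → ℝ}
    {w : ℝ → ℝ → ℝ} (hw : IsLayerSolution L T a f w) {x t : ℝ} (hx : x ∈ Ioc 0 L)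
    (ht : t ∈ Ioc 0 T) :
    HasDerivWithinAt (fun y => w y t) (partialX L w x t) (Icc 0 L) x := by
  have h1 := (hw.smooth.differentiableOn one_ne_zero (x, t) ⟨hx, ht⟩).hasFDerivWithinAt
  have h2 : HasDerivWithinAt (fun y : ℝ => (y, t)) ((1 : ℝ), (0 : ℝ)) (Ioc 0 L) x :=
    (hasDerivWithinAt_id x _).prodMk (hasDerivWithinAt_const x _ t)
  have hmaps : MapsTo (fun y : ℝ => (y, t)) (Ioc 0 L) (domain L T) := fun y hy => ⟨hy, ht⟩
  have h3 := (h1.comp_hasDerivWithinAt x h2 hmaps).differentiableWithinAt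
  refine (h3.mono_of_mem_nhdsWithin ?_).hasDerivWithinAt
  filter_upwards [self_mem_nhdsWithin, mem_nhdsWithin_of_mem_nhds (Ioi_mem_nhds hx.1)] with y h4 h5
  exact ⟨h5, h4.2⟩

theorem IsLayerSolution.hasDerivWithinAt_snd {L T : ℝ} {a : ℝ → ℝ → ℝ} {f : ℝ → ℝ}
    {w : ℝ → ℝ → ℝ} (hw : IsLayerSolution L T a f w) {x t : ℝ} (hx : x ∈ Ioc 0 L)
    (ht : t ∈ Ioc 0 T) :
    HasDerivWithinAt (fun s => w x s) (partialT T w x t) (Icc 0 T) t := by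
  have h1 := (hw.smooth.differentiableOn one_ne_zero (x, t) ⟨hx, ht⟩).hasFDerivWithinAt
  have h2 : HasDerivWithinAt (fun s : ℝ => (x, s)) ((0 : ℝ), (1 : ℝ)) (Ioc 0 T) t :=
    (hasDerivWithinAt_const t _ x).prodMk (hasDerivWithinAt_id t _)
  have hmaps : MapsTo (fun s : ℝ => (x, s)) (Ioc 0 T) (domain L T) := fun s hs => ⟨hx, hs⟩
  have h3 := (h1.comp_hasDerivWithinAt t h2 hmaps).differentiableWithinAt
  refine (h3.mono_of_mem_nhdsWithin ?_).hasDerivWithinAt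
  filter_upwards [self_mem_nhdsWithin, mem_nhdsWithin_of_mem_nhds (Ioi_mem_nhds ht.1)] with s h4 h5
  exact ⟨h5, h4.2⟩

/-- One side (`τ = 1` or `τ = -1`) of the error estimate, from a bound on the residual: a multiple
of `layerPrimitive` is a barrier for the error. -/
theorem error_le_barrier {L T α D ε τ : ℝ} {a : ℝ → ℝ → ℝ} {f : ℝ → ℝ} {N M : ℕ}
    {x t : ℕ → ℝ} {w : ℝ → ℝ → ℝ} {W : ℕ → ℕ → ℝ} (hN : 0 < N) (hM : 0 < M) (hT : 0 < T)
    (hα : 0 < α) (hε : 0 < ε) (hD : 0 < D) (hτ : |τ| = 1)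
    (ha : ∀ y ∈ Icc 0 L, ∀ s ∈ Icc 0 T, α ≤ a y s) (hw : IsLayerSolution L T a f w)
    (hx : IsMesh L N x) (ht : IsMesh T M t) (hin : ∀ j ≤ M, W 0 j = 0)
    (hb : ∀ i < N, ∀ y ∈ Icc (x i) (x (i + 1)),
      |a y 0 * ((W (i + 1) 0 - W i 0) / (x (i + 1) - x i)) - f y|
        < α * (D * (1 + layerWeight ε y)))
    (hr : ∀ i < N, ∀ j < M, ∀ y ∈ Icc (x i) (x (i + 1)), ∀ s ∈ Icc (t j) (t (j + 1)),
      |((W i (j + 1) - W i j) / (t (j + 1) - t j) * ((x (i + 1) - y) / (x (i + 1) - x i))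
          + (W (i + 1) (j + 1) - W (i + 1) j) / (t (j + 1) - t j)
            * ((y - x i) / (x (i + 1) - x i)))
        + a y s *
          ((W (i + 1) j - W i j) / (x (i + 1) - x i) * ((t (j + 1) - s) / (t (j + 1) - t j))
          + (W (i + 1) (j + 1) - W i (j + 1)) / (x (i + 1) - x i)
            * ((s - t j) / (t (j + 1) - t j))) - f y| < α * (D * (1 + layerWeight ε y))) :
    ∀ y ∈ Icc 0 L, ∀ s ∈ Icc 0 T,
      τ * (interpolant N M x t W y s - w y s) ≤ D * layerPrimitive ε y := by
  have hτle : ∀ r, τ * r ≤ |r| := fun r => by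
    rw [← one_mul |r|, ← hτ, ← abs_mul]; exact le_abs_self _
  have h0T : (0 : ℝ) ∈ Icc 0 T := ⟨le_rfl, hT.le⟩
  have hcellx : ∀ {i}, i < N → ∀ {y}, y ∈ Icc (x i) (x (i + 1)) → y ∈ Icc (0 : ℝ) L :=
    fun hi _ hy => ⟨(hx.mem hi.le).1.trans hy.1, hy.2.trans (hx.mem hi).2⟩
  have hcellt : ∀ {j}, j < M → ∀ {s}, s ∈ Icc (t j) (t (j + 1)) → s ∈ Icc (0 : ℝ) T :=
    fun hj _ hs => ⟨(ht.mem hj.le).1.trans hs.1, hs.2.trans (ht.mem hj).2⟩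
  have h0cell : (0 : ℝ) ∈ Icc (t 0) (t (0 + 1)) := ⟨ht.zero.le, ht.zero ▸ (ht.lt 0 hM).le⟩
  have hmul : ∀ {y s}, y ∈ Icc 0 L → s ∈ Icc 0 T →
      α * (D * (1 + layerWeight ε y)) ≤ a y s * (D * (1 + layerWeight ε y)) := fun hy hs =>
    mul_le_mul_of_nonneg_right (ha _ hy _ hs)
      (mul_nonneg hD.le (add_nonneg zero_le_one (layerWeight_nonneg hε _)))
  have key := nonpos_of_transport_neg_on_cells
    (E := fun y s => τ * (interpolant N M x t W y s - w y s) - D * layerPrimitive ε y) hN hM hx ht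
    ?_ ?_ ?_ ?_
  · intro y hy s hs
    exact sub_nonpos.1 (key y hy s hs)
  · intro i hi j hj
    have hc : ContinuousOn (fun z : ℝ × ℝ =>
        τ * (cellInterpolant x t W i j z.1 z.2 - w z.1 z.2) - D * layerPrimitive ε z.1)
        (Icc (x i) (x (i + 1)) ×ˢ Icc (t j) (t (j + 1))) := by
      refine ContinuousOn.sub (ContinuousOn.mul continuousOn_const ((continuous_cellInterpolant x t
        W i j).continuousOn.sub (hw.cont.mono fun z hz =>
        (⟨hcellx hi hz.1, hcellt hj hz.2⟩ : z ∈ closedDomain L T)))) ?_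
      unfold layerPrimitive
      fun_prop
    refine hc.congr fun z hz => ?_
    simp only
    rw [interpolant_eq_cellInterpolant hx ht W hi hj hz.1 hz.2]
  · intro s hs
    obtain ⟨j, hj, hsj⟩ := ht.exists_cell hM hs
    have h0cellx : (0 : ℝ) ∈ Icc (x 0) (x (0 + 1)) := ⟨hx.zero.le, hx.zero ▸ (hx.lt 0 hN).le⟩
    have e := interpolant_eq_cellInterpolant hx ht W hN hj
      h0cellx hsj
    have e' : cellInterpolant x t W 0 j 0 s = 0 := by
      simp [cellInterpolant, hx.zero, hin j hj.le, hin (j + 1) hj]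
    rw [e, e', hw.inflow s hs, layerPrimitive_zero]
    simp
  · intro i hi y hy
    have hyc : y ∈ Icc (x i) (x (i + 1)) := Ioc_subset_Icc_self hy
    have hyL := hcellx hi hyc
    have hsub : Icc (x i) y ⊆ Icc (x i) (x (i + 1)) := Icc_subset_Icc_right hy.2
    have d1 := (hasDerivAt_cellInterpolant_fst x t W i 0 y 0).hasDerivWithinAt (s := Icc (x i) y)
    have d2 := ((hw.initial_differentiable y hyL).hasDerivWithinAt).mono
      (hsub.trans fun z hz => hcellx hi hz)
    have d3 := (hasDerivAt_layerPrimitive hε y).hasDerivWithinAt (s := Icc (x i) y)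
    have d := (((d1.sub d2).const_mul τ).sub (d3.const_mul D))
    refine ⟨_, d.congr (fun z hz => ?_) ?_, ?_⟩
    · rw [interpolant_eq_cellInterpolant hx ht W hi hM (hsub hz) h0cell]; rfl
    · rw [interpolant_eq_cellInterpolant hx ht W hi hM hyc h0cell]; rfl
    · have hi0 := hw.initial y hyL
      unfold partialX at hi0
      have hk : t (0 + 1) - t 0 ≠ 0 := (sub_pos.2 (ht.lt 0 hM)).ne'
      have hpos : 0 < a y 0 := hα.trans_le (ha y hyL 0 h0T)
      have hlt := (hτle _).trans_lt ((hb i hi y hyc).trans_le (hmul hyL h0T))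
      have h1 : (t (0 + 1) - 0) / (t (0 + 1) - t 0) = 1 := by
        rw [ht.zero, sub_zero] at *; exact div_self hk
      have h2 : (0 - t 0) / (t (0 + 1) - t 0) = 0 := by rw [ht.zero, sub_zero, zero_div]
      rw [h1, h2]
      refine lt_of_mul_lt_mul_left (a := a y 0) ?_ hpos.le
      rw [← hi0] at hlt
      rw [mul_zero]
      linarith
  · intro i hi j hj y hy s hs
    have hyc : y ∈ Icc (x i) (x (i + 1)) := Ioc_subset_Icc_self hy
    have hsc : s ∈ Icc (t j) (t (j + 1)) := Ioc_subset_Icc_self hs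
    have hyL := hcellx hi hyc
    have hsT := hcellt hj hsc
    have hy0 : y ∈ Ioc 0 L := ⟨(hx.mem hi.le).1.trans_lt hy.1, hyL.2⟩
    have hs0 : s ∈ Ioc 0 T := ⟨(ht.mem hj.le).1.trans_lt hs.1, hsT.2⟩
    have hsubx : Icc (x i) y ⊆ Icc (x i) (x (i + 1)) := Icc_subset_Icc_right hy.2
    have hsubt : Icc (t j) s ⊆ Icc (t j) (t (j + 1)) := Icc_subset_Icc_right hs.2
    have d1 := (hasDerivAt_cellInterpolant_fst x t W i j y s).hasDerivWithinAt (s := Icc (x i) y)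
    have d2 := (hw.hasDerivWithinAt_fst hy0 hs0).mono (hsubx.trans fun z hz => hcellx hi hz)
    have d3 := (hasDerivAt_layerPrimitive hε y).hasDerivWithinAt (s := Icc (x i) y)
    have e1 := (hasDerivAt_cellInterpolant_snd x t W i j y s).hasDerivWithinAt (s := Icc (t j) s)
    have e2 := (hw.hasDerivWithinAt_snd hy0 hs0).mono (hsubt.trans fun z hz => hcellt hj hz)
    refine ⟨a y s, _, _, hα.le.trans (ha y hyL s hsT),
      (((d1.sub d2).const_mul τ).sub (d3.const_mul D)).congr (fun z hz => ?_) ?_,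
      (((e1.sub e2).const_mul τ).sub_const (D * layerPrimitive ε y)).congr (fun z hz => ?_) ?_, ?_⟩
    · rw [interpolant_eq_cellInterpolant hx ht W hi hj (hsubx hz) hsc]; rfl
    · rw [interpolant_eq_cellInterpolant hx ht W hi hj hyc hsc]; rfl
    · rw [interpolant_eq_cellInterpolant hx ht W hi hj hyc (hsubt hz)]; rfl
    · rw [interpolant_eq_cellInterpolant hx ht W hi hj hyc hsc]; rfl
    · have hlt := (hτle _).trans_lt ((hr i hi j hj y hyc s hsc).trans_le (hmul hyL hsT))
      rw [← hw.pde y hy0 s hs0] at hlt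
      linarith

end Transport

theorem mainTheorem3 (L T α K : ℝ) (hL : 0 < L) (hT : 0 < T) (hα : 0 < α)
    (a : ℝ → ℝ → ℝ) (ha : Transport.IsVelocity L T α a) :
    ∃ C : ℝ, 0 < C ∧
      ∀ ε : ℝ, 0 < ε → ε ≤ 1 →
      ∀ f : ℝ → ℝ, Transport.IsLayerForcing L K ε f →
      ∀ w : ℝ → ℝ → ℝ, Transport.IsLayerSolution L T a f w →
      ∀ N M : ℕ, 2 ≤ N → Even N → 1 ≤ M →
      ∀ W : ℕ → ℕ → ℝ,
        Transport.IsUpwindSolution a f N M (Transport.shishkinNode L ε N)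
          (Transport.uniformNode T M) W →
        ∀ x ∈ Set.Icc 0 L, ∀ t ∈ Set.Icc 0 T,
          |Transport.interpolant N M (Transport.shishkinNode L ε N)
              (Transport.uniformNode T M) W x t - w x t| ≤
            C * ((N : ℝ)⁻¹ * Real.log N ^ 2) + C * (M : ℝ)⁻¹ := by
  rcases lt_or_ge K 0 with hK | hK
  -- for negative `K` there is no admissible forcing term
  · exact ⟨1, one_pos, fun ε hε _ f hf => absurd (hf.const_nonneg hL hε) hK.not_ge⟩
  obtain ⟨A, Λ, hA, hΛ, hv⟩ := ha.exists_bounds hL hT hα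
  obtain ⟨C, hC, hbound⟩ :=
    Transport.IsUpwindSolution.exists_abs_spaceDiff_le hL hT hα hA hΛ hK hv
  set R := C * (1 + Λ + A) + 2 * K with hR
  have hR0 : 0 ≤ R := by positivity
  refine ⟨(R + 1) / α * (L + 2) * (8 * L + T), by positivity,
    fun ε hε _ f hf w hw N M hN hNe hM W hW x hx t ht => ?_⟩
  obtain ⟨hmx, hstep⟩ := Transport.shishkinNode_isMesh hL hε hN hNe
  have hmt := Transport.isMesh_uniformNode hT hM
  have hN' : (0 : ℝ) < N := by exact_mod_cast (by omega : 0 < N)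
  have hM' : (0 : ℝ) < M := by exact_mod_cast hM
  have hD := hbound ε f N M _ W hε hf hmx hmt hW
  have hδ : 0 < 2 * L / N + T / M := by positivity
  have hlt : ∀ y, R * (2 * L / N + T / M) * (1 + Transport.layerWeight ε y)
      < α * ((R + 1) / α * (2 * L / N + T / M) * (1 + Transport.layerWeight ε y)) := fun y => by
    have h1 := Transport.layerWeight_nonneg hε y
    have e : α * ((R + 1) / α * (2 * L / N + T / M) * (1 + Transport.layerWeight ε y))
        = (R + 1) * (2 * L / N + T / M) * (1 + Transport.layerWeight ε y) := by field_simp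
    rw [e]
    gcongr
    linarith
  have key : ∀ τ : ℝ, |τ| = 1 → τ * (Transport.interpolant N M (Transport.shishkinNode L ε N)
      (Transport.uniformNode T M) W x t - w x t)
      ≤ (R + 1) / α * (2 * L / N + T / M) * Transport.layerPrimitive ε x := fun τ hτ =>
    Transport.error_le_barrier (by omega) hM hT hα hε (by positivity) hτ hv.lower hw hmx hmt
      hW.inflow
      (fun i hi y hy => (hW.abs_initial_residual_le hL hT hα hΛ hε hv hf hmx hmt hC hD hstep hi
        hy).trans_lt (hlt y))
      (fun i hi j hj y hy s hs => (hW.abs_residual_le hL hα hΛ hε hv hf hmx hmt hC hD hstep rfl hi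
        hj hy hs).trans_lt (hlt y)) x hx t ht
  have h1 := key 1 abs_one
  have h2 := key (-1) (by rw [abs_neg, abs_one])
  have hp : Transport.layerPrimitive ε x ≤ L + 2 :=
    (Transport.layerPrimitive_le ε x).trans (by linarith [hx.2])
  -- the sharper rate `N⁻¹` is absorbed, as `log N ≥ log 2 > 1 / 2`
  have hlog : 1 ≤ 4 * Real.log N ^ 2 := by
    have h3 : Real.log 2 ≤ Real.log N := Real.log_le_log two_pos (by exact_mod_cast hN)
    have h4 := Real.log_two_gt_d9
    nlinarith
  have hN4 : 2 * L / N ≤ 8 * L * ((N : ℝ)⁻¹ * Real.log N ^ 2) := by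
    have := mul_le_mul_of_nonneg_left hlog (by positivity : 0 ≤ 2 * L * (N : ℝ)⁻¹)
    rw [div_eq_mul_inv]
    linarith
  have hfin : (R + 1) / α * (2 * L / N + T / M) * Transport.layerPrimitive ε x
      ≤ (R + 1) / α * (8 * L * ((N : ℝ)⁻¹ * Real.log N ^ 2) + T * (M : ℝ)⁻¹) * (L + 2) := by
    have := Transport.layerPrimitive_nonneg hε hx.1
    rw [div_eq_mul_inv T]
    gcongr
  have hc1 : 0 ≤ (R + 1) / α * (L + 2) * (T * ((N : ℝ)⁻¹ * Real.log N ^ 2)) := by positivity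
  have hc2 : 0 ≤ (R + 1) / α * (L + 2) * (8 * L * (M : ℝ)⁻¹) := by positivity
  rw [abs_le]
  constructor <;> linarith
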